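/- Manifolds are smooth ($C^\infty$), finite-dimensional and without boundary. For a Riemannian manifold $M$, $d_M$ denotes its Riemannian distance (the infimum of the lengths of $C^1$ curves joining two points, equal to $\infty$ if there is none). Let $M$, $N$ be Riemannian manifolds and let $F:M\to N$ be a Lipschitz map. For $x\in M$, the generalized differential of $F$ at $x$ in the sense of Clarke is \[ \partial F(x):=\operatorname{Conv}\Bigl\{\lim_{i\to\infty}dF_{x_i}\ \Bigm|\ x_i\to x,\ F \text{ is differentiable at every } x_i,\ \text{the limit exists}\Bigr\}, \] a set of linear maps $T_xM\to T_{F(x)}N$, where $\operatorname{Conv}$ is the convex hull and the limits are taken in local charts around $x$ and $F(x)$. The point $x$ is called non-singular for $F$ if every element of $\partial F(x)$ has maximal rank $\min(\dim M,\dim N)$, and singular otherwise. Theorem. Let $F$ be a bi-Lipschitz homeomorphism from a compact Riemannian manifold $M$ onto a Riemannian manifold $N$; that is, $F$ is a homeomorphism, and $F$ and $F^{-1}$ are Lipschitz with respect to $d_M$ and $d_N$. If $F$ has no singular points on $M$ and $F^{-1}$ has no singular points on $N$, then $M$ and $N$ are ($C^\infty$-)diffeomorphic. -/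

import Mathlib

open Set Filter Topology
open scoped NNReal Manifold ContDiff Bundle

noncomputable section

section Clarke

variable {E : Type*} [NormedAddCommGroup E] [NormedSpace ℝ E]
  {H : Type*} [TopologicalSpace H] (I : ModelWithCorners ℝ E H)
  {M : Type*} [TopologicalSpace M] [ChartedSpace H M]
  {E' : Type*} [NormedAddCommGroup E'] [NormedSpace ℝ E']
  {H' : Type*} [TopologicalSpace H'] (J : ModelWithCorners ℝ E' H')
  {N : Type*} [TopologicalSpace N] [ChartedSpace H' N]

/-- The linear maps `A : T_x M → T_{F x} N` of the form `lim dF_{x_i}`, where `x_i → x` is a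
sequence of points at which `F` is differentiable. The tangent spaces at points near `x` and near
`F x` are identified with the model spaces `E` and `E'` through the preferred charts at `x` and at
`F x` (at `x` and `F x` themselves this is Mathlib's identification of `TangentSpace I x` with `E`
and of `TangentSpace J (F x)` with `E'`), so that `dF_{x_i}` is the derivative, at the image of
`x_i`, of the expression of `F` in these two charts. Another choice of charts composes the limits
with fixed linear isomorphisms on both sides. -/
def limitDifferentials (F : M → N) (x : M) : Set (E →L[ℝ] E') :=
  {A | ∃ u : ℕ → M, (∀ i, MDifferentiableAt I J F (u i)) ∧ Tendsto u atTop (𝓝 x) ∧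
    Tendsto (fun i => fderivWithin ℝ (writtenInExtChartAt I J x F) (range I)
      (extChartAt I x (u i))) atTop (𝓝 A)}

/-- Clarke's generalized differential `∂F(x)`: the convex hull of the limits of differentials. -/
def generalizedDifferential (F : M → N) (x : M) : Set (E →L[ℝ] E') :=
  convexHull ℝ (limitDifferentials I J F x)

/-- `x` is non-singular for `F` in the sense of Clarke: every element of `∂F(x)` has maximal rank,
that is, rank `min (dim M) (dim N)`. -/
def IsClarkeNonsingularAt (F : M → N) (x : M) : Prop :=
  ∀ A ∈ generalizedDifferential I J F x,
    Module.finrank ℝ (LinearMap.range (A : E →ₗ[ℝ] E')) =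
      min (Module.finrank ℝ E) (Module.finrank ℝ E')

end Clarke

end

/-! The proof smooths `F` by mollification in charts, and the difficulty is to keep the map
injective with invertible differential. The property that survives smoothing is coercivity. Near a
non-singular point p the differentials of `F` lie close to the compact convex set ∂F(p) of injective
maps. For a fixed step v the vectors A v, with A in ∂F(p), form a compact convex set missing 0, so
one functional w is bounded below on it by a multiple of ‖v‖. Integrating along lines gives w(F(y+v)
- F(y)) ≥ c‖v‖ with the same w for every base point y near p (`coerciveAt_of_forall_injective`).

Since w depends on v but not on y, this condition on increments is convex. Mollifying replaces an
increment by an average of increments with the same v, so the condition is preserved. It also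
survives cutoffs and chart changes, up to the constant (`exists_smoothing`, `CoerciveAt.comp_left`,
`CoerciveAt.comp_right`). Finitely many local smoothings give a smooth, coercive, injective g
uniformly close to `F` (`exists_nhds_smoothing`, `exists_contMDiff_mem_nhds`).

Coercivity makes dg injective, hence invertible, because M and N have the same dimension (compare
Hausdorff dimensions). So g is open, its image is clopen, and closeness to `F` makes the image meet
every component of N. Thus g is a bijective local diffeomorphism
(`nonempty_diffeomorph_of_mCoerciveAt`). -/

set_option linter.unusedSectionVars false

/-! ### Coercive maps and their stability under composition. -/

section Coercive

variable {E : Type*} [NormedAddCommGroup E] [NormedSpace ℝ E]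
  {E' : Type*} [NormedAddCommGroup E'] [NormedSpace ℝ E']
  {E'' : Type*} [NormedAddCommGroup E''] [NormedSpace ℝ E'']

/-- The closed convex set of increments allowed for the step `v`. -/
def admissibleIncrements (w : E' →L[ℝ] ℝ) (C a : ℝ) : Set E' :=
  {u | a ≤ w u ∧ ‖u‖ ≤ C * a}

theorem convex_admissibleIncrements (w : E' →L[ℝ] ℝ) (C a : ℝ) :
    Convex ℝ (admissibleIncrements w C a) := by
  have h1 : Convex ℝ {u : E' | a ≤ w u} := convex_halfSpace_ge w.isLinear a
  have h2 : Convex ℝ {u : E' | ‖u‖ ≤ C * a} := by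
    have := convex_closedBall (0 : E') (C * a)
    simpa [Metric.closedBall, dist_zero_right] using this
  exact h1.inter h2

theorem isClosed_admissibleIncrements (w : E' →L[ℝ] ℝ) (C a : ℝ) :
    IsClosed (admissibleIncrements w C a) :=
  (isClosed_le continuous_const w.continuous).inter (isClosed_le continuous_norm continuous_const)

/-- `h` is Lipschitz on `U`, and for every step `v` a single bounded functional detects all
increments of `h` by `v` inside `U`. -/
def CoerciveOn (h : E → E') (U : Set E) (C : ℝ) : Prop :=
  ∀ v : E, ∃ w : E' →L[ℝ] ℝ, ‖w‖ ≤ C ∧ ∀ y ∈ U, y + v ∈ U →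
    h (y + v) - h y ∈ admissibleIncrements w C ‖v‖

/-- `h` is coercive on a neighbourhood of `p`. -/
def CoerciveAt (h : E → E') (p : E) : Prop :=
  ∃ C : ℝ, ∃ U ∈ 𝓝 p, CoerciveOn h U C

theorem CoerciveOn.nonneg {h : E → E'} {U : Set E} {C : ℝ} (H : CoerciveOn h U C) : 0 ≤ C := by
  obtain ⟨w, hw, -⟩ := H 0
  exact (norm_nonneg w).trans hw

theorem CoerciveOn.mono {h : E → E'} {U V : Set E} {C : ℝ} (H : CoerciveOn h U C) (hV : V ⊆ U) :
    CoerciveOn h V C := fun v => by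
  obtain ⟨w, hw, hw'⟩ := H v
  exact ⟨w, hw, fun y hy hy' => hw' y (hV hy) (hV hy')⟩

theorem CoerciveOn.congr {h k : E → E'} {U : Set E} {C : ℝ} (H : CoerciveOn h U C)
    (hk : EqOn k h U) : CoerciveOn k U C := fun v => by
  obtain ⟨w, hw, hw'⟩ := H v
  refine ⟨w, hw, fun y hy hy' => ?_⟩
  rw [hk hy, hk hy']
  exact hw' y hy hy'

theorem CoerciveOn.norm_sub_le {h : E → E'} {U : Set E} {C : ℝ} (H : CoerciveOn h U C) {x y : E}
    (hx : x ∈ U) (hy : y ∈ U) : ‖h x - h y‖ ≤ C * ‖x - y‖ := by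
  obtain ⟨w, -, hw'⟩ := H (x - y)
  have := (hw' y hy (by simpa using hx)).2
  simpa using this

theorem CoerciveOn.le_norm_sub {h : E → E'} {U : Set E} {C : ℝ} (H : CoerciveOn h U C) {x y : E}
    (hx : x ∈ U) (hy : y ∈ U) : ‖x - y‖ ≤ C * ‖h x - h y‖ := by
  obtain ⟨w, hw, hw'⟩ := H (x - y)
  have := (hw' y hy (by simpa using hx)).1
  simp only [add_sub_cancel] at this
  calc ‖x - y‖ ≤ w (h x - h y) := this
    _ ≤ ‖w (h x - h y)‖ := Real.le_norm_self _
    _ ≤ ‖w‖ * ‖h x - h y‖ := w.le_opNorm _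
    _ ≤ C * ‖h x - h y‖ := by gcongr

theorem CoerciveOn.injOn {h : E → E'} {U : Set E} {C : ℝ} (H : CoerciveOn h U C) :
    InjOn h U := fun x hx y hy hxy => by
  have := H.le_norm_sub hx hy
  rw [hxy, sub_self, norm_zero, mul_zero] at this
  exact sub_eq_zero.1 (norm_le_zero_iff.1 this)

theorem CoerciveOn.continuousOn {h : E → E'} {U : Set E} {C : ℝ} (H : CoerciveOn h U C) :
    ContinuousOn h U := by
  have : LipschitzOnWith C.toNNReal h U := LipschitzOnWith.of_dist_le_mul fun x hx y hy => by
    rw [dist_eq_norm, dist_eq_norm, Real.coe_toNNReal _ H.nonneg]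
    exact H.norm_sub_le hx hy
  exact this.continuousOn

theorem CoerciveAt.continuousAt {h : E → E'} {p : E} (H : CoerciveAt h p) : ContinuousAt h p := by
  obtain ⟨C, U, hU, H⟩ := H
  exact H.continuousOn.continuousAt hU

theorem CoerciveAt.congr {h k : E → E'} {p : E} (H : CoerciveAt h p) (hk : k =ᶠ[𝓝 p] h) :
    CoerciveAt k p := by
  obtain ⟨C, U, hU, H⟩ := H
  exact ⟨C, U ∩ {x | k x = h x}, inter_mem hU hk, (H.mono inter_subset_left).congr fun x hx => hx.2⟩

/-- The lower bound ‖v‖ ≤ C‖h(p+v) - h(p)‖ is homogeneous, so it passes to the limit of difference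
quotients. -/
theorem CoerciveAt.injective_of_hasFDerivAt {h : E → E'} {p : E} (H : CoerciveAt h p)
    {A : E →L[ℝ] E'} (hA : HasFDerivAt h A p) : Function.Injective A := by
  obtain ⟨C, U, hU, H⟩ := H
  rw [injective_iff_map_eq_zero]
  intro v hv
  have hlim : Tendsto (fun t : ℝ => t • (h (p + t⁻¹ • v) - h p)) atTop (𝓝 (A v)) :=
    hA.lim_real v
  have hmem : ∀ᶠ t : ℝ in atTop, p + t⁻¹ • v ∈ U := by
    have : Tendsto (fun t : ℝ => p + t⁻¹ • v) atTop (𝓝 (p + (0 : ℝ) • v)) :=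
      tendsto_const_nhds.add (tendsto_inv_atTop_zero.smul_const v)
    rw [zero_smul, add_zero] at this
    exact this hU
  have hle : ∀ᶠ t : ℝ in atTop, ‖v‖ ≤ C * ‖t • (h (p + t⁻¹ • v) - h p)‖ := by
    filter_upwards [hmem, eventually_gt_atTop 0] with t ht ht0
    have := H.le_norm_sub ht (mem_of_mem_nhds hU)
    simp only [add_sub_cancel_left, norm_smul, norm_inv, Real.norm_of_nonneg ht0.le] at this ⊢
    rw [inv_mul_le_iff₀ ht0] at this
    linarith
  have h2 : ‖v‖ ≤ C * ‖A v‖ := ge_of_tendsto (hlim.norm.const_mul C) hle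
  rw [hv, norm_zero, mul_zero] at h2
  exact norm_le_zero_iff.1 h2

/-- A perturbation that is small relative to the step preserves admissibility. -/
theorem add_mem_admissibleIncrements {w : E' →L[ℝ] ℝ} {C a D : ℝ} {u e : E'}
    (hu : u ∈ admissibleIncrements w C a) (hw : ‖w‖ ≤ C) (ha : 0 ≤ a)
    (he : C * ‖e‖ ≤ a / 2) (he' : ‖e‖ ≤ a) (hD : 2 * C + 1 ≤ D) :
    u + e ∈ admissibleIncrements ((2 : ℝ) • w) D a := by
  obtain ⟨h1, h2⟩ := hu
  have h3 : |w e| ≤ C * ‖e‖ := (w.le_opNorm e).trans (by gcongr)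
  have hC : 0 ≤ C := (norm_nonneg w).trans hw
  refine ⟨?_, ?_⟩
  · simp only [smul_apply, map_add, smul_eq_mul]
    linarith [neg_abs_le (w e)]
  · calc ‖u + e‖ ≤ ‖u‖ + ‖e‖ := norm_add_le _ _
      _ ≤ C * a + a := by linarith
      _ ≤ (2 * C + 1) * a := by nlinarith
      _ ≤ D * a := by gcongr

/-- By strict differentiability, increments of ψ ∘ h are B applied to increments of h, up to an
error small relative to the step. The functional w is transported by B⁻¹ and doubled to absorb the
error. -/
theorem CoerciveAt.comp_left {h : E → E'} {p : E} (H : CoerciveAt h p) {ψ : E' → E''}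
    {B : E' ≃L[ℝ] E''} (hψ : HasStrictFDerivAt ψ (B : E' →L[ℝ] E'') (h p)) :
    CoerciveAt (ψ ∘ h) p := by
  have hc := H.continuousAt
  obtain ⟨C, U, hU, H⟩ := H
  have hC := H.nonneg
  set b : ℝ := ‖(B.symm : E'' →L[ℝ] E')‖ with hb
  have hb0 : 0 ≤ b := norm_nonneg _
  -- With this η the error costs w ∘ B⁻¹ at most C·b·η·C‖v‖ ≤ ‖v‖/2. The added 1 keeps the
  -- denominator positive.
  let η : ℝ≥0 := ⟨1 / (2 * C * C * b + 1), by positivity⟩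
  have hη : (0 : ℝ) < η := by change (0 : ℝ) < 1 / (2 * C * C * b + 1); positivity
  have hη' : 2 * C * C * b * η ≤ 1 := by
    change 2 * C * C * b * (1 / (2 * C * C * b + 1)) ≤ 1
    rw [mul_one_div, div_le_one (by positivity)]; linarith
  obtain ⟨V, hV, hVa⟩ := hψ.approximates_deriv_on_nhds (c := η) (Or.inr (by exact_mod_cast hη))
  set D : ℝ := max (2 * C * b) (‖(B : E' →L[ℝ] E'')‖ * C + η * C) with hD
  refine ⟨D, U ∩ h ⁻¹' V, inter_mem hU (hc hV), fun v => ?_⟩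
  obtain ⟨w, hw, hw'⟩ := H v
  refine ⟨(2 : ℝ) • w.comp (B.symm : E'' →L[ℝ] E'), ?_, ?_⟩
  · refine le_trans ?_ (le_max_left _ _)
    rw [norm_smul, Real.norm_of_nonneg zero_le_two, mul_assoc]
    gcongr
    exact (w.opNorm_comp_le _).trans (by gcongr)
  · rintro y ⟨hyU, hyV⟩ ⟨hyU', hyV'⟩
    obtain ⟨h1, h2⟩ := hw' y hyU hyU'
    set Δ := h (y + v) - h y with hΔ
    have happ := hVa _ hyV' _ hyV
    set e := ψ (h (y + v)) - ψ (h y) - B Δ with he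
    have he1 : ‖e‖ ≤ η * (C * ‖v‖) := happ.trans (by gcongr)
    have hsum : (ψ ∘ h) (y + v) - (ψ ∘ h) y = B Δ + e := by simp [he]
    rw [hsum]
    refine ⟨?_, ?_⟩
    · have h3 : |w (B.symm e)| ≤ C * (b * (η * (C * ‖v‖))) := by
        calc |w (B.symm e)| ≤ ‖w‖ * ‖B.symm e‖ := w.le_opNorm _
          _ ≤ C * (b * ‖e‖) := by
            gcongr
            exact (B.symm : E'' →L[ℝ] E').le_opNorm e
          _ ≤ _ := by gcongr
      have h4 : (2 * C * C * b * η) * ‖v‖ ≤ 1 * ‖v‖ := by gcongr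
      simp only [smul_apply, ContinuousLinearMap.comp_apply, map_add,
        smul_eq_mul, ContinuousLinearEquiv.coe_coe, ContinuousLinearEquiv.symm_apply_apply]
      nlinarith [neg_abs_le (w (B.symm e))]
    · calc ‖B Δ + e‖ ≤ ‖B Δ‖ + ‖e‖ := norm_add_le _ _
        _ ≤ ‖(B : E' →L[ℝ] E'')‖ * (C * ‖v‖) + η * (C * ‖v‖) := by
          gcongr
          exact ((B : E' →L[ℝ] E'').le_opNorm Δ).trans (by gcongr)
        _ = (‖(B : E' →L[ℝ] E'')‖ * C + η * C) * ‖v‖ := by ring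
        _ ≤ D * ‖v‖ := by gcongr; exact le_max_right _ _

/-- A step v becomes nearly the step A v, with a defect independent of the base point to first
order. So the functional attached to A v serves for v, and the Lipschitz bound on h controls the
defect. -/
theorem CoerciveAt.comp_right {h : E → E'} {p : E''} {φ : E'' → E} (H : CoerciveAt h (φ p))
    {A : E'' ≃L[ℝ] E} (hφ : HasStrictFDerivAt φ (A : E'' →L[ℝ] E) p) :
    CoerciveAt (h ∘ φ) p := by
  obtain ⟨C, U, hU, H⟩ := H
  have hC := H.nonneg
  set b : ℝ := ‖(A.symm : E →L[ℝ] E'')‖ with hb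
  have hb0 : 0 ≤ b := norm_nonneg _
  let η : ℝ≥0 := ⟨1 / (2 * C * C * b + 1), by positivity⟩
  have hη : (0 : ℝ) < η := by change (0 : ℝ) < 1 / (2 * C * C * b + 1); positivity
  have hη' : 2 * C * C * b * η ≤ 1 := by
    change 2 * C * C * b * (1 / (2 * C * C * b + 1)) ≤ 1
    rw [mul_one_div, div_le_one (by positivity)]; linarith
  obtain ⟨V, hV, hVa⟩ := hφ.approximates_deriv_on_nhds (c := η) (Or.inr (by exact_mod_cast hη))
  obtain ⟨s, hs, hsU⟩ := Metric.mem_nhds_iff.1 hU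
  set D : ℝ := max (2 * b * C) (C * (‖(A : E'' →L[ℝ] E)‖ + η)) with hD
  -- Two points within this radius of p differ by v with η‖v‖ < s/2, so φ y + A v stays in the
  -- s-ball where h is coercive.
  have hr : 0 < s / 2 / (2 * η) := by positivity
  refine ⟨D, V ∩ φ ⁻¹' Metric.ball (φ p) (s / 2) ∩ Metric.ball p (s / 2 / (2 * η)),
    inter_mem (inter_mem hV (hφ.continuousAt (Metric.ball_mem_nhds _ (by positivity))))
      (Metric.ball_mem_nhds _ hr), fun v => ?_⟩
  obtain ⟨w, hw, hw'⟩ := H (A v)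
  refine ⟨(2 * b) • w, ?_, ?_⟩
  · refine le_trans ?_ (le_max_left _ _)
    rw [norm_smul, Real.norm_of_nonneg (by positivity)]
    gcongr
  · rintro y ⟨⟨hyV, hyU⟩, hyr⟩ ⟨⟨hyV', hyU'⟩, hyr'⟩
    have happ := hVa _ hyV' _ hyV
    simp only [add_sub_cancel_left, ContinuousLinearEquiv.coe_coe] at happ
    have hvr : ‖v‖ < 2 * (s / 2 / (2 * η)) := by
      have := dist_triangle_right (y + v) y p
      rw [dist_eq_norm, add_sub_cancel_left] at this
      have h1 := Metric.mem_ball.1 hyr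
      have h2 := Metric.mem_ball.1 hyr'
      linarith
    have hηv : η * ‖v‖ < s / 2 := by
      calc (η : ℝ) * ‖v‖ < η * (2 * (s / 2 / (2 * η))) := by gcongr
        _ = s / 2 := by field_simp
    have hmem0 : φ y ∈ U := hsU (Metric.ball_subset_ball (by linarith) hyU)
    have hmem1 : φ (y + v) ∈ U := hsU (Metric.ball_subset_ball (by linarith) hyU')
    have hmem : φ y + A v ∈ U := by
      apply hsU
      have h1 : dist (φ y + A v) (φ (y + v)) < s / 2 := by
        rw [dist_comm, dist_eq_norm, ← sub_sub]
        exact happ.trans_lt hηv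
      have := dist_triangle (φ y + A v) (φ (y + v)) (φ p)
      have h2 := Metric.mem_ball.1 hyU'
      rw [Metric.mem_ball]; linarith
    obtain ⟨h1, h2⟩ := hw' _ hmem0 hmem
    set Δ := h (φ y + A v) - h (φ y) with hΔ
    set e := h (φ (y + v)) - h (φ y + A v) with he
    have he1 : ‖e‖ ≤ C * (η * ‖v‖) := by
      refine (H.norm_sub_le hmem1 hmem).trans ?_
      rw [← sub_sub]
      gcongr
    have hsum : (h ∘ φ) (y + v) - (h ∘ φ) y = Δ + e := by simp [he, hΔ]
    rw [hsum]
    refine ⟨?_, ?_⟩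
    · have h3 : |w e| ≤ C * (C * (η * ‖v‖)) := (w.le_opNorm e).trans (by gcongr)
      have h4 : (2 * C * C * b * η) * ‖v‖ ≤ 1 * ‖v‖ := by gcongr
      have h5 : ‖v‖ ≤ b * ‖A v‖ := by
        simpa using (A.symm : E →L[ℝ] E'').le_opNorm (A v)
      have h6 : b * ‖A v‖ ≤ b * w Δ := by gcongr
      have h7 : b * |w e| ≤ b * (C * (C * (η * ‖v‖))) := by gcongr
      have h8 : b * (- |w e|) ≤ b * w e := by gcongr; exact neg_abs_le _
      simp only [smul_apply, map_add, smul_eq_mul]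
      nlinarith
    · calc ‖Δ + e‖ ≤ ‖Δ‖ + ‖e‖ := norm_add_le _ _
        _ ≤ C * (‖(A : E'' →L[ℝ] E)‖ * ‖v‖) + C * (η * ‖v‖) := by
          gcongr
          exact h2.trans (by gcongr; exact (A : E'' →L[ℝ] E).le_opNorm v)
        _ = (C * (‖(A : E'' →L[ℝ] E)‖ + η)) * ‖v‖ := by ring
        _ ≤ D * ‖v‖ := by gcongr; exact le_max_right _ _

end Coercive

/-! ### Mollification preserves coercivity. -/

section Smoothing

open MeasureTheory

variable {E : Type*} [NormedAddCommGroup E] [NormedSpace ℝ E]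
  {E' : Type*} [NormedAddCommGroup E'] [NormedSpace ℝ E']

/-- Blending `h` with `k`, which has the same detecting functionals, by a cutoff `χ`. -/
theorem CoerciveOn.blend {h k : E → E'} {V : Set E} {C Λ η : ℝ} {χ : E → ℝ}
    (hhk : ∀ v : E, ∃ w : E' →L[ℝ] ℝ, ‖w‖ ≤ C ∧ ∀ y ∈ V, y + v ∈ V →
      h (y + v) - h y ∈ admissibleIncrements w C ‖v‖ ∧
      k (y + v) - k y ∈ admissibleIncrements w C ‖v‖)
    (hχ : ∀ y, χ y ∈ Icc (0 : ℝ) 1) (hχL : ∀ x ∈ V, ∀ y ∈ V, |χ x - χ y| ≤ Λ * ‖x - y‖)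
    (hΛ : 0 ≤ Λ)
    (hη : ∀ y ∈ V, ‖k y - h y‖ ≤ η) (hη1 : C * (Λ * η) ≤ 1 / 2) (hη2 : Λ * η ≤ 1) :
    CoerciveOn (fun y => h y + χ y • (k y - h y)) V (2 * C + 1) := by
  intro v
  obtain ⟨w, hw, hw'⟩ := hhk v
  have hC : 0 ≤ C := (norm_nonneg w).trans hw
  refine ⟨(2 : ℝ) • w, ?_, fun y hy hy' => ?_⟩
  · rw [norm_smul, Real.norm_of_nonneg zero_le_two]; linarith
  obtain ⟨ha, hb⟩ := hw' y hy hy'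
  have hu := (convex_admissibleIncrements w C ‖v‖) ha hb
    (sub_nonneg.2 (hχ y).2) (hχ y).1 (sub_add_cancel 1 (χ y))
  -- With the cutoff frozen at y, the increment is a convex combination of admissible ones. The
  -- remainder carries χ(y+v) - χ(y), hence is at most Λη‖v‖.
  have hdec : (h (y + v) + χ (y + v) • (k (y + v) - h (y + v))) - (h y + χ y • (k y - h y)) =
      ((1 - χ y) • (h (y + v) - h y) + χ y • (k (y + v) - k y)) +
        (χ (y + v) - χ y) • (k (y + v) - h (y + v)) := by
    module
  have he : ‖(χ (y + v) - χ y) • (k (y + v) - h (y + v))‖ ≤ (Λ * η) * ‖v‖ := by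
    rw [norm_smul, Real.norm_eq_abs]
    have h1 := hχL _ hy' _ hy
    rw [add_sub_cancel_left] at h1
    calc _ ≤ (Λ * ‖v‖) * η := by
          gcongr
          exact hη _ hy'
      _ = _ := by ring
  change (h (y + v) + χ (y + v) • (k (y + v) - h (y + v))) - (h y + χ y • (k y - h y)) ∈ _
  rw [hdec]
  refine add_mem_admissibleIncrements hu hw (norm_nonneg v) ?_ ?_ le_rfl
  · calc C * _ ≤ C * ((Λ * η) * ‖v‖) := by gcongr
      _ = (C * (Λ * η)) * ‖v‖ := by ring
      _ ≤ 1 / 2 * ‖v‖ := by gcongr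
      _ = ‖v‖ / 2 := by ring
  · exact he.trans (by nlinarith [norm_nonneg v])

variable [FiniteDimensional ℝ E] [FiniteDimensional ℝ E'] [MeasurableSpace E] [BorelSpace E]

/-- A weighted average over a bump function stays in a closed convex set. -/
theorem ContDiffBump.integral_normed_smul_mem {μ : Measure E} [μ.IsAddHaarMeasure]
    (φ : ContDiffBump (0 : E)) {S : Set E'} (hS : Convex ℝ S) (hSc : IsClosed S) {g : E → E'}
    (hg : Integrable (fun z => φ.normed μ z • g z) μ) (hgS : ∀ z, ‖z‖ < φ.rOut → g z ∈ S) :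
    ∫ z, φ.normed μ z • g z ∂μ ∈ S := by
  let ρ : E → ℝ≥0 := fun z => (φ.normed μ z).toNNReal
  have hρ : ∀ z, (ρ z : ℝ) = φ.normed μ z := fun z => Real.coe_toNNReal _ (φ.nonneg_normed z)
  have hρm : Measurable ρ := (φ.continuous_normed.measurable).real_toNNReal
  -- The normalized bump is the density of a probability measure, so the integral is a mean of
  -- values in S.
  let ν : Measure E := μ.withDensity fun z => (ρ z : ENNReal)
  have hν : IsProbabilityMeasure ν := by
    refine ⟨?_⟩
    rw [withDensity_apply _ MeasurableSet.univ, Measure.restrict_univ]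
    have : ∀ z, (ρ z : ENNReal) = ENNReal.ofReal (φ.normed μ z) := fun z => rfl
    simp_rw [this]
    rw [← ofReal_integral_eq_lintegral_ofReal φ.integrable_normed
      (Eventually.of_forall φ.nonneg_normed), φ.integral_normed, ENNReal.ofReal_one]
  have hint : Integrable g ν := by
    rw [integrable_withDensity_iff_integrable_smul hρm]
    refine hg.congr (Eventually.of_forall fun z => ?_)
    change φ.normed μ z • g z = (ρ z : ℝ) • g z
    rw [hρ]
  have hae : ∀ᵐ z ∂ν, g z ∈ S := by
    rw [ae_withDensity_iff hρm.coe_nnreal_ennreal]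
    refine Eventually.of_forall fun z hz => hgS z ?_
    have : φ.normed μ z ≠ 0 := by
      intro h0
      apply hz
      simp [ρ, h0]
    have hz' : z ∈ Function.support (φ.normed μ) := this
    rw [φ.support_normed_eq] at hz'
    simpa using hz'
  have := hS.integral_mem hSc hae hint
  rw [integral_withDensity_eq_integral_smul hρm] at this
  convert this using 2
  ext z
  change φ.normed μ z • g z = (ρ z : ℝ) • g z
  rw [hρ]

theorem integrable_bump_smul {μ : Measure E} [μ.IsAddHaarMeasure] (φ : ContDiffBump (0 : E))
    {f : E → E'} (hf : LocallyIntegrable f μ) (y : E) :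
    Integrable (fun z => φ.normed μ z • f (y - z)) μ :=
  φ.hasCompactSupport_normed.convolutionExists_left (ContinuousLinearMap.lsmul ℝ ℝ)
    φ.continuous_normed hf y

/-- Local smoothing of a coercive map: a sequence of maps, equal to `h` outside a ball, smooth on a
smaller ball, converging uniformly to `h`, and coercive uniformly along the sequence. -/
theorem exists_smoothing {h : E → E'} {p₀ : E} {r : ℝ} (hr : 0 < r)
    (hc : ContinuousOn h (Metric.closedBall p₀ (3 * r)))
    (hco : ∀ p ∈ Metric.ball p₀ (3 * r), CoerciveAt h p) :
    ∃ k : ℕ → E → E',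
      (∀ j, ∀ y ∉ Metric.ball p₀ (2 * r), k j y = h y) ∧
      (∀ j, ContinuousOn (k j) (Metric.closedBall p₀ (3 * r))) ∧
      TendstoUniformlyOn k h atTop (Metric.closedBall p₀ (3 * r)) ∧
      (∀ j, ContDiffOn ℝ ∞ (k j) (Metric.ball p₀ r)) ∧
      (∀ j, ∀ y, ContDiffAt ℝ ∞ h y → ContDiffAt ℝ ∞ (k j) y) ∧
      (∀ p ∈ Metric.ball p₀ (3 * r), ∃ C, ∃ U ∈ 𝓝 p, ∀ᶠ j in atTop, CoerciveOn (k j) U C) := by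
  let μ : Measure E := Measure.addHaar
  let φ : ℕ → ContDiffBump (0 : E) := fun j =>
    ⟨1 / (2 * ((j : ℝ) + 1)), 1 / ((j : ℝ) + 1), by positivity, by
      apply one_div_lt_one_div_of_lt <;> [positivity; linarith [(Nat.cast_nonneg j : (0:ℝ) ≤ j)]]⟩
  have hφ : Tendsto (fun j => (φ j).rOut) atTop (𝓝 0) := tendsto_one_div_add_atTop_nhds_zero_nat
  let χ : ContDiffBump p₀ := ⟨r, 2 * r, hr, by linarith⟩
  let B := Metric.closedBall p₀ (3 * r)
  -- Continuity of h is known only on the ball, so its extension by zero is mollified. Well inside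
  -- the ball, small bump radii never see the difference.
  let f : E → E' := B.indicator h
  have hf : LocallyIntegrable f μ := by
    have : IntegrableOn h B μ := hc.integrableOn_compact (isCompact_closedBall _ _)
    exact (this.integrable_indicator measurableSet_closedBall).locallyIntegrable
  let m : ℕ → E → E' := fun j =>
    convolution ((φ j).normed μ) f (ContinuousLinearMap.lsmul ℝ ℝ) μ
  have hm : ∀ j, ContDiff ℝ ∞ (m j) := fun j =>
    (φ j).hasCompactSupport_normed.contDiff_convolution_left _ (φ j).contDiff_normed hf
  have hfB : ∀ y ∈ B, f y = h y := fun y hy => indicator_of_mem hy _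
  have hmS : ∀ j y, ∀ S : Set E', Convex ℝ S → IsClosed S →
      (∀ z, ‖z‖ < (φ j).rOut → f (y - z) ∈ S) → m j y ∈ S := fun j y S hS hSc hz => by
    exact (φ j).integral_normed_smul_mem (μ := μ) hS hSc (integrable_bump_smul (φ j) hf y) hz
  have hunif : ∀ ε > 0, ∀ t > 0, ∀ᶠ j in atTop, ∀ y, Metric.ball y t ⊆ B → ‖m j y - h y‖ ≤ ε := by
    intro ε hε t ht
    have huc := (isCompact_closedBall p₀ (3 * r)).uniformContinuousOn_of_continuous hc
    rw [Metric.uniformContinuousOn_iff_le] at huc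
    obtain ⟨δ, hδ, huc⟩ := huc ε hε
    filter_upwards [hφ.eventually (gt_mem_nhds hδ), hφ.eventually (gt_mem_nhds ht)] with j hj hj' y hy
    have : m j y ∈ Metric.closedBall (h y) ε := by
      refine hmS j y _ (convex_closedBall _ _) Metric.isClosed_closedBall fun z hz => ?_
      have hzB : y - z ∈ B := hy (by simpa using hz.trans hj')
      rw [hfB _ hzB]
      exact huc _ hzB _ (hy (Metric.mem_ball_self ht)) (by simpa using (hz.trans hj).le)
    simpa [dist_eq_norm] using this
  have hχ0 : ∀ y ∉ Metric.ball p₀ (2 * r), χ y = 0 := fun y hy =>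
    χ.zero_of_le_dist (by simpa using hy)
  refine ⟨fun j y => h y + χ y • (m j y - h y), ?_, ?_, ?_, ?_, ?_, ?_⟩
  · intro j y hy
    simp [hχ0 y hy]
  · intro j
    exact hc.add (χ.continuous.continuousOn.smul ((hm j).continuous.continuousOn.sub hc))
  · rw [Metric.tendstoUniformlyOn_iff]
    intro ε hε
    filter_upwards [hunif (ε / 2) (by positivity) r hr] with j hj y _
    rw [dist_comm, dist_eq_norm, add_sub_cancel_left, norm_smul, Real.norm_of_nonneg χ.nonneg]
    by_cases hy : y ∈ Metric.ball p₀ (2 * r)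
    · have h1 := hj y fun z hz => by
        have h1 := dist_triangle z y p₀
        have h2 := Metric.mem_ball.1 hy
        have h3 := Metric.mem_ball.1 hz
        exact Metric.mem_closedBall.2 (by linarith)
      have h2 : χ y ≤ 1 := χ.le_one
      nlinarith [norm_nonneg (m j y - h y)]
    · rw [hχ0 y hy, zero_mul]; exact hε
  · intro j
    refine (hm j).contDiffOn.congr fun y hy => ?_
    simp [χ.one_of_mem_closedBall (Metric.ball_subset_closedBall hy)]
  · intro j y hy
    exact hy.add (χ.contDiff.contDiffAt.smul ((hm j).contDiffAt.sub hy))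
  · intro p hp
    obtain ⟨C, U, hU, H⟩ := hco p hp
    have hC := H.nonneg
    obtain ⟨s, hs, hsU⟩ := Metric.mem_nhds_iff.1 (inter_mem hU (Metric.isOpen_ball.mem_nhds hp))
    obtain ⟨Λ, V, hV, hΛ⟩ : ∃ Λ : ℝ≥0, ∃ V ∈ 𝓝 p, LipschitzOnWith Λ χ V :=
      (χ.contDiff (n := 1)).locallyLipschitz p
    -- One choice meets both smallness conditions of `CoerciveOn.blend`: CΛη ≤ 1/2 and Λη ≤ 1.
    set η : ℝ := 1 / (2 * (C + 1) * (Λ + 1)) with hη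
    have hη0 : 0 < η := by positivity
    have hη1 : (C + 1) * ((Λ + 1) * η) = 1 / 2 := by
      rw [hη]; field_simp
    refine ⟨2 * C + 1, V ∩ Metric.ball p (s / 2), inter_mem hV (Metric.ball_mem_nhds _ (by positivity)),
      ?_⟩
    have hsub : ∀ y ∈ Metric.ball p (s / 2), Metric.ball y (s / 2) ⊆ Metric.ball p s :=
      fun y hy => Metric.ball_subset_ball' (by linarith [Metric.mem_ball.1 hy])
    filter_upwards [hunif η hη0 (s / 2) (half_pos hs), hφ.eventually (gt_mem_nhds (half_pos hs))]
      with j hj hjs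
    have hΛη : (Λ : ℝ) * η ≤ (Λ + 1) * η := by gcongr; linarith
    have hΛη0 : 0 ≤ (Λ : ℝ) * η := by positivity
    refine CoerciveOn.blend (χ := χ) (Λ := Λ) (η := η) ?_ (fun y => ⟨χ.nonneg, χ.le_one⟩) ?_ Λ.2 ?_ ?_ ?_
    · intro v
      obtain ⟨w, hw, hw'⟩ := H v
      refine ⟨w, hw, fun y hy hyv => ?_⟩
      have hmem : ∀ z, ‖z‖ < s / 2 → ∀ y ∈ Metric.ball p (s / 2), y - z ∈ Metric.ball p s :=
        fun z hz y hy => hsub y hy (by simpa using hz)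
      have hhB : ∀ y ∈ Metric.ball p s, f y = h y := fun y hy =>
        hfB y (Metric.ball_subset_closedBall (hsU hy).2)
      refine ⟨hw' y (hsU (hsub y hy.2 (Metric.mem_ball_self (half_pos hs)))).1
        (hsU (hsub _ hyv.2 (Metric.mem_ball_self (half_pos hs)))).1, ?_⟩
      -- The key point: the increment of the mollification averages increments of h by the same v,
      -- all detected by the same w.
      have hsubint : m j (y + v) - m j y =
          ∫ z, (φ j).normed μ z • (f (y + v - z) - f (y - z)) ∂μ := by
        simp_rw [smul_sub]
        rw [integral_sub (integrable_bump_smul (φ j) hf _) (integrable_bump_smul (φ j) hf _)]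
        rfl
      rw [hsubint]
      refine (φ j).integral_normed_smul_mem (μ := μ) (convex_admissibleIncrements _ _ _)
        (isClosed_admissibleIncrements _ _ _) ?_ fun z hz => ?_
      · simp_rw [smul_sub]
        exact (integrable_bump_smul (φ j) hf _).sub (integrable_bump_smul (φ j) hf _)
      · have h1 := hmem z (hz.trans hjs) y hy.2
        have h2 := hmem z (hz.trans hjs) _ hyv.2
        rw [hhB _ h1, hhB _ h2]
        rw [add_sub_right_comm] at h2 ⊢
        exact hw' _ (hsU h1).1 (hsU h2).1
    · intro x hx y hy
      have := hΛ.dist_le_mul x hx.1 y hy.1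
      rwa [Real.dist_eq, dist_eq_norm] at this
    · intro y hy
      exact hj y ((hsub y hy.2).trans fun z hz => Metric.ball_subset_closedBall (hsU hz).2)
    · nlinarith
    · nlinarith

end Smoothing

/-! ### Compactness of convex hulls. -/

section ConvexHull

/-- In finite dimension the convex hull of a compact set is compact. -/
theorem IsCompact.convexHull_of_finiteDimensional {V : Type*} [NormedAddCommGroup V]
    [NormedSpace ℝ V] [FiniteDimensional ℝ V] {K : Set V} (hK : IsCompact K) :
    IsCompact (convexHull ℝ K) := by
  -- By Carathéodory this many points suffice. Shorter combinations are padded with zero weights, so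
  -- the hull is the continuous image of a fixed compact set.
  let d := Module.finrank ℝ V + 1
  let Φ : (Fin d → ℝ) × (Fin d → V) → V := fun q => ∑ i, q.1 i • q.2 i
  have hΦ : Continuous Φ := by fun_prop
  have hc : IsCompact (stdSimplex ℝ (Fin d) ×ˢ (univ.pi fun _ : Fin d => K)) :=
    (isCompact_stdSimplex ℝ (Fin d)).prod (isCompact_univ_pi fun _ => hK)
  convert hc.image hΦ using 1
  apply Subset.antisymm
  · intro x hx
    obtain ⟨x₀, hx₀⟩ : K.Nonempty := convexHull_nonempty_iff.1 ⟨x, hx⟩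
    obtain ⟨ι, _, z, w, hz, haff, hw, hw1, hsum⟩ := eq_pos_convex_span_of_mem_convexHull hx
    have hcard : Fintype.card ι ≤ Fintype.card (Fin d) := by
      rw [Fintype.card_fin]
      exact haff.card_le_finrank_succ.trans
        (Nat.succ_le_succ (Submodule.finrank_le _))
    obtain ⟨e⟩ := Function.Embedding.nonempty_of_card_le hcard
    have hz0 : ∀ i, i ∉ Finset.univ.map e → Function.extend e w 0 i = 0 := fun i hi =>
      Function.extend_apply' _ _ _ (by simpa using hi)
    refine ⟨(Function.extend e w 0, Function.extend e z fun _ => x₀), ⟨⟨fun i => ?_, ?_⟩, ?_⟩, ?_⟩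
    · change 0 ≤ Function.extend e w 0 i
      by_cases hi : ∃ a, e a = i
      · obtain ⟨a, rfl⟩ := hi
        rw [e.injective.extend_apply]
        exact (hw a).le
      · rw [Function.extend_apply' _ _ _ hi]; rfl
    · rw [← Finset.sum_subset (Finset.subset_univ (Finset.univ.map e)) fun i _ hi => hz0 i hi,
        Finset.sum_map]
      simpa only [e.injective.extend_apply] using hw1
    · intro i _
      by_cases hi : ∃ a, e a = i
      · obtain ⟨a, rfl⟩ := hi
        simp only [e.injective.extend_apply]
        exact hz ⟨a, rfl⟩
      · simp only [Function.extend_apply' _ _ _ hi]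
        exact hx₀
    · simp only [Φ]
      rw [← Finset.sum_subset (Finset.subset_univ (Finset.univ.map e)) fun i _ hi => by
        rw [hz0 i hi, zero_smul], Finset.sum_map]
      simpa only [e.injective.extend_apply] using hsum
  · rintro _ ⟨⟨w, z⟩, ⟨⟨hw, hw1⟩, hz⟩, rfl⟩
    exact (convex_convexHull ℝ K).sum_mem (fun i _ => hw i) hw1
      fun i _ => subset_convexHull ℝ K (hz i (mem_univ i))

end ConvexHull

/-! ### From almost everywhere derivative bounds to increments. -/

section Increments

open MeasureTheory

variable {E : Type*} [NormedAddCommGroup E] [NormedSpace ℝ E] [FiniteDimensional ℝ E]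
  {E' : Type*} [NormedAddCommGroup E'] [NormedSpace ℝ E'] [FiniteDimensional ℝ E']
  [MeasurableSpace E] [BorelSpace E]

/-- A lower bound for the derivative in direction `v`, almost everywhere on a convex open set,
bounds from below the increments by `v` of a Lipschitz function. -/
theorem LipschitzWith.le_increment_of_ae_le_fderiv {μ : Measure E} [μ.IsAddHaarMeasure]
    {u : E → ℝ} {L : ℝ≥0} (hu : LipschitzWith L u) {U : Set E} (hU : IsOpen U) (hUc : Convex ℝ U)
    {v : E} {c : ℝ} (hc : ∀ᵐ q ∂μ, q ∈ U → c ≤ fderiv ℝ u q v) {y : E} (hy : y ∈ U)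
    (hyv : y + v ∈ U) : c ≤ u (y + v) - u y := by
  obtain ⟨η₁, hη₁, hb₁⟩ := Metric.isOpen_iff.1 hU y hy
  obtain ⟨η₂, hη₂, hb₂⟩ := Metric.isOpen_iff.1 hU _ hyv
  -- The segment from y to y + v may lie in the null set where nothing is known about the
  -- derivative. Averaging over translates by z with ‖z‖ < η avoids this, and moves each endpoint
  -- value by at most Lη.
  suffices H : ∀ η : ℝ, 0 < η → η ≤ min η₁ η₂ → c ≤ u (y + v) - u y + 2 * L * η by
    have hlim : Tendsto (fun η : ℝ => u (y + v) - u y + 2 * L * η) (𝓝[>] 0)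
        (𝓝 (u (y + v) - u y + 2 * L * 0)) :=
      ((continuous_const.add (continuous_const.mul continuous_id)).tendsto 0).mono_left
        nhdsWithin_le_nhds
    rw [mul_zero, add_zero] at hlim
    refine ge_of_tendsto hlim ?_
    filter_upwards [Ioc_mem_nhdsGT (lt_min hη₁ hη₂)] with η hη using H η hη.1 hη.2
  intro η hη hηle
  let ν : Measure E := μ.restrict (Metric.ball 0 η)
  have hνfin : IsFiniteMeasure ν := ⟨by
    rw [Measure.restrict_apply_univ]; exact measure_ball_lt_top⟩
  set V : ℝ := ν.real univ with hV
  have hVpos : 0 < V := by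
    rw [hV, measureReal_def, Measure.restrict_apply_univ]
    exact ENNReal.toReal_pos (Metric.measure_ball_pos μ 0 hη).ne' measure_ball_lt_top.ne
  have hball : ∀ᵐ z ∂ν, z ∈ Metric.ball (0 : E) η := ae_restrict_mem measurableSet_ball
  have htrans : ∀ (a : E) {P : E → Prop}, (∀ᵐ q ∂μ, P q) → ∀ᵐ z ∂ν, P (a + z) := fun a P hP =>
    ae_restrict_of_ae ((measurePreserving_add_left μ a).quasiMeasurePreserving.ae hP)
  have hint : ∀ a : E, Integrable (fun z => u (a + z)) ν := by
    intro a
    refine Integrable.of_bound (C := ‖u a‖ + L * η)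
      ((hu.continuous.comp (continuous_const.add continuous_id)).aestronglyMeasurable) ?_
    filter_upwards [hball] with z hz
    have h1 := hu.dist_le_mul (a + z) a
    rw [dist_eq_norm, dist_eq_norm, add_sub_cancel_left] at h1
    have h2 : ‖z‖ ≤ η := by simpa using (Metric.mem_ball.1 hz).le
    have h3 : ‖u (a + z)‖ ≤ ‖u a‖ + ‖u (a + z) - u a‖ := by
      simpa using norm_add_le (u a) (u (a + z) - u a)
    have h4 : (L : ℝ) * ‖z‖ ≤ L * η := by gcongr
    linarith
  let I : ℝ → ℝ := fun t => ∫ z, u (y + t • v + z) ∂ν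
  have hderiv : ∀ t : ℝ, Integrable (fun z => fderiv ℝ u (y + t • v + z) v) ν ∧
      HasDerivAt I (∫ z, fderiv ℝ u (y + t • v + z) v ∂ν) t := by
    intro t
    refine hasDerivAt_integral_of_dominated_loc_of_lip (bound := fun _ => (L : ℝ) * ‖v‖)
      (s := univ) univ_mem (Eventually.of_forall fun s => (hint _).aestronglyMeasurable)
      (hint _) ?_ ?_ (integrable_const _) ?_
    · exact ((measurable_fderiv_apply_const ℝ u v).comp
        (measurable_const.add measurable_id)).aestronglyMeasurable
    · refine Eventually.of_forall fun z => LipschitzOnWith.of_dist_le_mul fun s _ s' _ => ?_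
      refine (hu.dist_le_mul _ _).trans ?_
      rw [dist_add_right, dist_add_left, dist_eq_norm, ← sub_smul, norm_smul, dist_eq_norm]
      simp only [Real.coe_nnabs]
      rw [abs_of_nonneg (by positivity)]
      exact le_of_eq (by ring)
    · filter_upwards [htrans (y + t • v) (hu.ae_differentiableAt (μ := μ))] with z hz
      have h1 : HasDerivAt (fun s : ℝ => y + s • v + z) v t := by
        simpa using (((hasDerivAt_id t).smul_const v).const_add y).add_const z
      exact hz.hasFDerivAt.comp_hasDerivAt t h1
  have hlow : ∀ t ∈ Icc (0 : ℝ) 1, c * V ≤ ∫ z, fderiv ℝ u (y + t • v + z) v ∂ν := by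
    intro t ht
    have : c * V = ∫ _, c ∂ν := by rw [integral_const, smul_eq_mul, mul_comm]
    rw [this]
    refine integral_mono_ae (integrable_const _) (hderiv t).1 ?_
    filter_upwards [htrans (y + t • v) hc, hball] with z hz hzb
    apply hz
    have hz' : ‖z‖ < η := by simpa using hzb
    have h1 : y + z ∈ U := hb₁ (by simpa using hz'.trans_le (hηle.trans (min_le_left _ _)))
    have h2 : y + v + z ∈ U := hb₂ (by simpa using hz'.trans_le (hηle.trans (min_le_right _ _)))
    have := hUc h1 h2 (sub_nonneg.2 ht.2) ht.1 (sub_add_cancel 1 t)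
    convert this using 1
    module
  have hI : c * V ≤ I 1 - I 0 := by
    have := (convex_Icc (0 : ℝ) 1).mul_sub_le_image_sub_of_le_deriv (f := I) (C := c * V)
      (fun t _ => (hderiv t).2.continuousAt.continuousWithinAt)
      (fun t _ => (hderiv t).2.differentiableAt.differentiableWithinAt)
      (fun t ht => by
        rw [(hderiv t).2.deriv]
        exact hlow t (interior_subset ht)) 0 (by simp) 1 (by simp) zero_le_one
    simpa using this
  have hup : I 1 - I 0 ≤ (u (y + v) - u y + 2 * L * η) * V := by
    have : (u (y + v) - u y + 2 * L * η) * V = ∫ _, (u (y + v) - u y + 2 * L * η) ∂ν := by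
      rw [integral_const, smul_eq_mul, mul_comm]
    rw [this, ← integral_sub (hint _) (hint _)]
    refine integral_mono_ae ((hint _).sub (hint _)) (integrable_const _) ?_
    filter_upwards [hball] with z hz
    have hz' : ‖z‖ ≤ η := by simpa using (Metric.mem_ball.1 hz).le
    have h1 := hu.dist_le_mul (y + v + z) (y + v)
    have h2 := hu.dist_le_mul (y + z) y
    rw [dist_eq_norm, dist_eq_norm, add_sub_cancel_left, Real.norm_eq_abs] at h1 h2
    have h3 : (L : ℝ) * ‖z‖ ≤ L * η := by gcongr
    simp only [one_smul, zero_smul, add_zero]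
    linarith [le_abs_self (u (y + v + z) - u (y + v)), neg_abs_le (u (y + z) - u y)]
  exact le_of_mul_le_mul_right (hI.trans hup) hVpos

/-- Composing with w makes the map scalar, so it extends to a globally Lipschitz function.
Rademacher's theorem then makes a bound at the differentiability points of h an almost everywhere
bound. -/
theorem LipschitzOnWith.le_increment_of_le_fderiv {h : E → E'} {L : ℝ≥0} {U : Set E}
    (hh : LipschitzOnWith L h U) (hU : IsOpen U) (hUc : Convex ℝ U) {v : E} {c : ℝ}
    (w : E' →L[ℝ] ℝ) (hc : ∀ q ∈ U, DifferentiableAt ℝ h q → c ≤ w (fderiv ℝ h q v)) {y : E}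
    (hy : y ∈ U) (hyv : y + v ∈ U) : c ≤ w (h (y + v) - h y) := by
  obtain ⟨u, hu, hEq⟩ := (w.lipschitz.comp_lipschitzOnWith hh).extend_real
  have hmain := hu.le_increment_of_ae_le_fderiv (μ := Measure.addHaar) hU hUc (v := v) (c := c) ?_
    hy hyv
  · rwa [← hEq hy, ← hEq hyv, Function.comp_apply, Function.comp_apply, ← map_sub] at hmain
  · filter_upwards [hh.ae_differentiableWithinAt_of_mem (μ := Measure.addHaar)] with q hq hqU
    have hd : DifferentiableAt ℝ h q := (hq hqU).differentiableAt (hU.mem_nhds hqU)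
    have heq : u =ᶠ[𝓝 q] w ∘ h := by
      filter_upwards [hU.mem_nhds hqU] with x hx using (hEq hx).symm
    rw [heq.fderiv_eq, (w.hasFDerivAt.comp q hd.hasFDerivAt).fderiv]
    exact hc q hqU hd

end Increments

/-! ### Limits of differentials. -/

section ClarkeLimits

variable {E : Type*} [NormedAddCommGroup E] [NormedSpace ℝ E]
  {E' : Type*} [NormedAddCommGroup E'] [NormedSpace ℝ E']

/-- The limits of differentials of a map between vector spaces. -/
def limitFDerivs (h : E → E') (p : E) : Set (E →L[ℝ] E') :=
  {A | ∃ q : ℕ → E, (∀ i, DifferentiableAt ℝ h (q i)) ∧ Tendsto q atTop (𝓝 p) ∧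
    Tendsto (fun i => fderiv ℝ h (q i)) atTop (𝓝 A)}

/-- The set is the slice over p of the closure of the graph of the differential. -/
theorem isClosed_limitFDerivs (h : E → E') (p : E) : IsClosed (limitFDerivs h p) := by
  let G : Set (E × (E →L[ℝ] E')) := {a | DifferentiableAt ℝ h a.1 ∧ a.2 = fderiv ℝ h a.1}
  have : limitFDerivs h p = (fun A => (p, A)) ⁻¹' closure G := by
    ext A
    rw [mem_preimage, mem_closure_iff_seq_limit]
    constructor
    · rintro ⟨q, hq, hqp, hqA⟩
      exact ⟨fun i => (q i, fderiv ℝ h (q i)), fun i => ⟨hq i, rfl⟩, hqp.prodMk_nhds hqA⟩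
    · rintro ⟨a, ha, hlim⟩
      refine ⟨fun i => (a i).1, fun i => (ha i).1, (continuous_fst.tendsto _).comp hlim, ?_⟩
      have := (continuous_snd.tendsto _).comp hlim
      exact this.congr fun i => (ha i).2
  rw [this]
  exact isClosed_closure.preimage (by fun_prop)

variable [FiniteDimensional ℝ E] [FiniteDimensional ℝ E']

theorem isCompact_limitFDerivs {h : E → E'} {p : E} {L : ℝ≥0} {U : Set E} (hU : U ∈ 𝓝 p)
    (hh : LipschitzOnWith L h U) : IsCompact (limitFDerivs h p) := by
  refine Metric.isCompact_of_isClosed_isBounded (isClosed_limitFDerivs h p)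
    ((Metric.isBounded_closedBall (x := 0) (r := (L : ℝ))).subset ?_)
  rintro A ⟨q, hq, hqp, hqA⟩
  rw [mem_closedBall_zero_iff]
  refine le_of_tendsto hqA.norm ?_
  filter_upwards [hqp.eventually (eventually_mem_nhds_iff.2 hU)] with i hi
  exact norm_fderiv_le_of_lipschitzOn ℝ hi hh

/-- Upper semicontinuity: differentials violating it along q → p are bounded by L, and a
subsequential limit would belong to the limit set. -/
theorem eventually_exists_limitFDerivs {h : E → E'} {p : E} {L : ℝ≥0} {U : Set E} (hU : U ∈ 𝓝 p)
    (hh : LipschitzOnWith L h U) {δ : ℝ} (hδ : 0 < δ) :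
    ∀ᶠ q in 𝓝 p, DifferentiableAt ℝ h q → ∃ A ∈ limitFDerivs h p, ‖fderiv ℝ h q - A‖ < δ := by
  by_contra hcon
  rw [not_eventually] at hcon
  have hfreq := hcon.and_eventually (eventually_mem_nhds_iff.2 hU)
  obtain ⟨q, hqp, hq⟩ := exists_seq_forall_of_frequently hfreq
  simp only [Classical.not_imp, not_exists, not_and, not_lt] at hq
  obtain ⟨A, -, φ, hφ, hA⟩ := tendsto_subseq_of_bounded
    (Metric.isBounded_closedBall (x := (0 : E →L[ℝ] E')) (r := (L : ℝ)))
    (x := fun i => fderiv ℝ h (q i)) fun i => by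
      rw [mem_closedBall_zero_iff]
      exact norm_fderiv_le_of_lipschitzOn ℝ (hq i).2 hh
  have hAmem : A ∈ limitFDerivs h p :=
    ⟨q ∘ φ, fun i => (hq _).1.1, hqp.comp hφ.tendsto_atTop, hA⟩
  have h1 : Tendsto (fun i => ‖fderiv ℝ h (q (φ i)) - A‖) atTop (𝓝 ‖A - A‖) :=
    (hA.sub_const A).norm
  rw [sub_self, norm_zero] at h1
  obtain ⟨i, hi⟩ := (h1.eventually (gt_mem_nhds hδ)).exists
  exact absurd hi (not_lt.2 ((hq (φ i)).1.2 A hAmem))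

/-- A compact set of injective linear maps is bounded below uniformly. -/
theorem exists_lower_bound_of_isCompact {S : Set (E →L[ℝ] E')} (hS : IsCompact S)
    (hinj : ∀ A ∈ S, Function.Injective A) :
    ∃ δ > 0, ∀ A ∈ S, ∀ v, δ * ‖v‖ ≤ ‖A v‖ := by
  have hcomp : IsCompact (S ×ˢ Metric.sphere (0 : E) 1) := hS.prod (isCompact_sphere _ _)
  have key : ∃ δ > 0, ∀ a ∈ S ×ˢ Metric.sphere (0 : E) 1, δ ≤ ‖a.1 a.2‖ := by
    rcases (S ×ˢ Metric.sphere (0 : E) 1).eq_empty_or_nonempty with he | hne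
    · exact ⟨1, one_pos, by simp [he]⟩
    · obtain ⟨a, ha, hmin⟩ := hcomp.exists_isMinOn hne
        (f := fun a : (E →L[ℝ] E') × E => ‖a.1 a.2‖) (by fun_prop)
      refine ⟨‖a.1 a.2‖, norm_pos_iff.2 fun h0 => ?_, fun b hb => hmin hb⟩
      have : a.2 = 0 := (hinj a.1 ha.1) (by rw [h0, map_zero])
      simpa [this] using ha.2
  obtain ⟨δ, hδ, hle⟩ := key
  refine ⟨δ, hδ, fun A hA v => ?_⟩
  rcases eq_or_ne v 0 with rfl | hv
  · simp
  · have hv' : 0 < ‖v‖ := norm_pos_iff.2 hv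
    have := hle (A, ‖v‖⁻¹ • v) ⟨hA, by simp [norm_smul, hv]⟩
    simp only [map_smul, norm_smul, norm_inv, norm_norm] at this
    rwa [← div_eq_inv_mul, le_div_iff₀ hv'] at this

end ClarkeLimits

/-! ### Clarke non-singularity implies coercivity. -/

section ClarkeCoercive

variable {E : Type*} [NormedAddCommGroup E] [NormedSpace ℝ E] [FiniteDimensional ℝ E]
  {E' : Type*} [NormedAddCommGroup E'] [InnerProductSpace ℝ E'] [FiniteDimensional ℝ E']

/-- A compact convex set at distance at least `a` from the origin is separated from it by a unit
functional. -/
theorem exists_functional_ge {S : Set E'} (hS : IsCompact S) (hSc : Convex ℝ S) {a : ℝ}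
    (ha : 0 < a) (hle : ∀ s ∈ S, a ≤ ‖s‖) :
    ∃ w : E' →L[ℝ] ℝ, ‖w‖ ≤ 1 ∧ ∀ s ∈ S, a ≤ w s := by
  rcases S.eq_empty_or_nonempty with rfl | hne
  · exact ⟨0, by simp, by simp⟩
  -- The functional is the inner product with the direction of u, the point of S nearest the origin.
  obtain ⟨u, hu, hmin⟩ := exists_norm_eq_iInf_of_complete_convex hne hS.isComplete hSc 0
  rw [norm_eq_iInf_iff_real_inner_le_zero hSc hu] at hmin
  have hu0 : 0 < ‖u‖ := ha.trans_le (hle u hu)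
  refine ⟨‖u‖⁻¹ • innerSL ℝ u, ?_, fun s hs => ?_⟩
  · rw [norm_smul, norm_inv, norm_norm, innerSL_apply_norm, inv_mul_cancel₀ hu0.ne']
  · have h1 := hmin s hs
    rw [zero_sub, inner_neg_left, inner_sub_right, real_inner_self_eq_norm_sq] at h1
    have h2 := hle u hu
    simp only [smul_apply, innerSL_apply_apply, smul_eq_mul]
    rw [← div_eq_inv_mul, le_div_iff₀ hu0]
    nlinarith

/-- A Lipschitz map whose Clarke differential consists of injective maps is coercive. -/
theorem coerciveAt_of_forall_injective {h : E → E'} {p : E} {L : ℝ≥0} {U : Set E} (hU : U ∈ 𝓝 p)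
    (hh : LipschitzOnWith L h U)
    (hinj : ∀ A ∈ convexHull ℝ (limitFDerivs h p), Function.Injective A) : CoerciveAt h p := by
  borelize E
  have hcomp := (isCompact_limitFDerivs hU hh).convexHull_of_finiteDimensional
  obtain ⟨δ, hδ, hlow⟩ := exists_lower_bound_of_isCompact hcomp hinj
  obtain ⟨s, hs, hsU⟩ := Metric.mem_nhds_iff.1
    (inter_mem hU (eventually_exists_limitFDerivs hU hh (half_pos hδ)))
  -- On this ball the differentials are δ/2-close to limit differentials, so half of the bound δ‖v‖
  -- survives. The factor 2/δ rescales it to ‖v‖.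
  refine ⟨max (2 / δ) L, Metric.ball p s, Metric.ball_mem_nhds _ hs, fun v => ?_⟩
  rcases eq_or_ne v 0 with rfl | hv
  · exact ⟨0, by simp, fun y _ _ => by simp [admissibleIncrements]⟩
  have hv' : 0 < ‖v‖ := norm_pos_iff.2 hv
  let ev : (E →L[ℝ] E') →L[ℝ] E' := ContinuousLinearMap.apply ℝ E' v
  obtain ⟨w, hw, hws⟩ := exists_functional_ge (hcomp.image ev.continuous)
    ((convex_convexHull ℝ _).is_linear_image ev.isLinear) (mul_pos hδ hv')
    (by rintro _ ⟨A, hA, rfl⟩; exact hlow A hA v)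
  refine ⟨(2 / δ) • w, ?_, fun y hy hyv => ⟨?_, ?_⟩⟩
  · refine le_trans ?_ (le_max_left _ _)
    rw [norm_smul, Real.norm_of_nonneg (by positivity)]
    exact mul_le_of_le_one_right (by positivity) hw
  · have key : δ / 2 * ‖v‖ ≤ w (h (y + v) - h y) := by
      refine (hh.mono fun x hx => (hsU hx).1).le_increment_of_le_fderiv Metric.isOpen_ball
        (convex_ball _ _) w (fun q hq hd => ?_) hy hyv
      obtain ⟨A, hA, hAq⟩ := (hsU hq).2 hd
      have h1 := hws _ (mem_image_of_mem ev (subset_convexHull ℝ _ hA))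
      have h2 : |w ((fderiv ℝ h q - A) v)| ≤ 1 * (δ / 2 * ‖v‖) :=
        (w.le_opNorm _).trans (by
          gcongr
          exact (ContinuousLinearMap.le_opNorm _ v).trans (by gcongr))
      have h3 : w (fderiv ℝ h q v) = w (A v) + w ((fderiv ℝ h q - A) v) := by
        rw [← map_add]; simp
      have h4 : ev A = A v := rfl
      rw [h4] at h1
      rw [h3]
      linarith [neg_abs_le (w ((fderiv ℝ h q - A) v))]
    simp only [smul_apply, smul_eq_mul]
    rw [div_mul_eq_mul_div, le_div_iff₀ hδ]
    linarith
  · have := hh.dist_le_mul _ (hsU hyv).1 _ (hsU hy).1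
    rw [dist_eq_norm, dist_eq_norm, add_sub_cancel_left] at this
    exact this.trans (by gcongr; exact le_max_right _ _)

end ClarkeCoercive

/-! ### Local bounds for trivializations of a Riemannian bundle. -/

section RiemannianBundleBounds

variable {B : Type*} [TopologicalSpace B]
  {F : Type*} [NormedAddCommGroup F] [NormedSpace ℝ F]
  {E : B → Type*} [TopologicalSpace (Bundle.TotalSpace F E)] [∀ x, NormedAddCommGroup (E x)]
  [∀ x, InnerProductSpace ℝ (E x)] [FiberBundle F E] [VectorBundle ℝ F E]
  [IsContinuousRiemannianBundle F E]

theorem eventually_enorm_trivializationAt_apply_le (x : B) :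
    ∃ C : ℝ≥0, ∀ᶠ y in 𝓝 x, ∀ v : E y,
      ‖(trivializationAt F E x).continuousLinearMapAt ℝ y v‖ₑ ≤ C * ‖v‖ₑ := by
  obtain ⟨C, hC0, hC⟩ := eventually_norm_trivializationAt_lt F E x
  lift C to ℝ≥0 using hC0.le
  refine ⟨C, ?_⟩
  filter_upwards [hC] with y hy v
  refine (ContinuousLinearMap.le_opENorm _ v).trans ?_
  gcongr
  have : ‖(trivializationAt F E x).continuousLinearMapAt ℝ y‖₊ ≤ C := hy.le
  exact_mod_cast this

theorem eventually_enorm_symmL_trivializationAt_apply_le (x : B) :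
    ∃ C : ℝ≥0, ∀ᶠ y in 𝓝 x, ∀ v : F,
      ‖(trivializationAt F E x).symmL ℝ y v‖ₑ ≤ C * ‖v‖ₑ := by
  obtain ⟨C, hC0, hC⟩ := eventually_norm_symmL_trivializationAt_lt F E x
  lift C to ℝ≥0 using hC0.le
  refine ⟨C, ?_⟩
  filter_upwards [hC] with y hy v
  refine (ContinuousLinearMap.le_opENorm _ v).trans ?_
  gcongr
  have : ‖(trivializationAt F E x).symmL ℝ y‖₊ ≤ C := hy.le
  exact_mod_cast this
end RiemannianBundleBounds

/-! ### Charts are locally bi-Lipschitz for the Riemannian distance. -/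

section RiemannianCharts

open MeasureTheory Manifold

variable {E : Type*} [NormedAddCommGroup E] [NormedSpace ℝ E]
  {H : Type*} [TopologicalSpace H] (I : ModelWithCorners ℝ E H)
  {M : Type*} [PseudoEMetricSpace M] [ChartedSpace H M]
  [Bundle.RiemannianBundle (fun x : M => TangentSpace I x)]
  [IsManifold I 1 M] [IsContinuousRiemannianBundle E (fun x : M => TangentSpace I x)]
  [IsRiemannianManifold I M]

theorem eventually_enorm_mfderiv_extChartAt_apply_le (x : M) :
    ∃ C : ℝ≥0, ∀ᶠ y in 𝓝 x, ∀ v : TangentSpace I y,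
      @enorm E _ (mfderiv I 𝓘(ℝ, E) (extChartAt I x) y v) ≤ C * ‖v‖ₑ := by
  rcases eventually_enorm_trivializationAt_apply_le (F := E)
    (E := fun x : M => TangentSpace I x) x with ⟨C, hC⟩
  refine ⟨C, ?_⟩
  filter_upwards [hC, chart_source_mem_nhds H x] with y hy h'y v
  have h2 := congr($(TangentBundle.continuousLinearMapAt_trivializationAt (I := I) h'y) v)
  exact (congrArg (@enorm E _) h2).symm.trans_le (hy v)

theorem eventually_enorm_mfderivWithin_symm_extChartAt_apply_le (x : M) :
    ∃ C : ℝ≥0, ∀ᶠ q in 𝓝[range I] (extChartAt I x x), ∀ v : E,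
      ‖(mfderiv[range I] (extChartAt I x).symm q (v : TangentSpace 𝓘(ℝ, E) q))‖ₑ ≤ C * ‖v‖ₑ := by
  rcases eventually_enorm_symmL_trivializationAt_apply_le (F := E)
    (E := fun x : M => TangentSpace I x) x with ⟨C, hC⟩
  refine ⟨C, ?_⟩
  have h0 : 𝓝 x = 𝓝 ((extChartAt I x).symm (extChartAt I x x)) := by simp
  have hC' := inter_mem hC (chart_source_mem_nhds H x)
  rw [h0] at hC'
  have h1 : ContinuousAt (extChartAt I x).symm (extChartAt I x x) := continuousAt_extChartAt_symm _
  filter_upwards [nhdsWithin_le_nhds (h1.preimage_mem_nhds hC'),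
    extChartAt_target_mem_nhdsWithin x] with q hq h'q v
  have hqq : extChartAt I x ((extChartAt I x).symm q) = q := (extChartAt I x).right_inv h'q
  have h2 := TangentBundle.symmL_trivializationAt (I := I) hq.2
  let g : E → E →L[ℝ] E := fun q => mfderiv[range I] (extChartAt I x).symm q
  have h3 : @Eq (E →L[ℝ] E) ((trivializationAt E (TangentSpace I) x).symmL ℝ
    ((extChartAt I x).symm q)) (g q) := h2.trans (congrArg g hqq)
  have h4 : @Eq E ((trivializationAt E (TangentSpace I) x).symmL ℝ
    ((extChartAt I x).symm q) v) (g q v) := congr($h3 v)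
  exact (congrArg (fun u : TangentSpace I ((extChartAt I x).symm q) => ‖u‖ₑ) h4).symm.trans_le
    (hq.1 v)

/-- The Riemannian distance of two points near `x` is controlled by their distance in the chart. -/
theorem eventually_edist_le_edist_extChartAt (x : M) :
    ∃ C : ℝ≥0, ∃ V ∈ 𝓝 x, ∀ y ∈ V, ∀ z ∈ V,
      edist y z ≤ C * edist (extChartAt I x y) (extChartAt I x z) := by
  rcases eventually_enorm_mfderivWithin_symm_extChartAt_apply_le I x with ⟨C, hC⟩
  obtain ⟨r, r_pos, hr⟩ : ∃ r > 0,
      Metric.ball (extChartAt I x x) r ∩ range I ⊆ (extChartAt I x).target ∩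
        {q | ∀ v : E, ‖(mfderiv[range I] (extChartAt I x).symm q (v : TangentSpace 𝓘(ℝ, E) q))‖ₑ ≤
          C * ‖v‖ₑ} :=
    Metric.mem_nhdsWithin_iff.1 (inter_mem (extChartAt_target_mem_nhdsWithin x) hC)
  have A : (extChartAt I x) ⁻¹' (Metric.ball (extChartAt I x x) r ∩ range I) ∈ 𝓝 x := by
    apply extChartAt_preimage_mem_nhds_of_mem_nhdsWithin (by simp)
    rw [inter_comm]
    exact inter_mem_nhdsWithin _ (Metric.ball_mem_nhds _ r_pos)
  refine ⟨C, _, inter_mem A (chart_source_mem_nhds H x), ?_⟩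
  rintro y ⟨hy, h'y⟩ z ⟨hz, h'z⟩
  -- The competing curve is the straight segment in the chart, pulled back to M.
  let η := ContinuousAffineMap.lineMap (R := ℝ) (extChartAt I x y) (extChartAt I x z)
  set γ := (extChartAt I x).symm ∘ η
  have hη : Icc 0 1 ⊆ ⇑η ⁻¹' ((extChartAt I x).target ∩
        {q | ∀ v : E, ‖(mfderiv[range I] (extChartAt I x).symm q (v : TangentSpace 𝓘(ℝ, E) q))‖ₑ ≤
          C * ‖v‖ₑ}) := by
    simp only [← image_subset_iff, ContinuousAffineMap.coe_lineMap_eq,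
     ← segment_eq_image_lineMap, η]
    apply Subset.trans _ hr
    exact ((convex_ball _ _).inter I.convex_range).segment_subset hy hz
  simp only [preimage_inter, subset_inter_iff] at hη
  have η_smooth : CMDiff[Icc 0 1] 1 η := by
    apply ContMDiff.contMDiffOn
    rw [contMDiff_iff_contDiff]
    exact ContinuousAffineMap.contDiff _
  rw [IsRiemannianManifold.out (I := I) y z]
  have : riemannianEDist I y z ≤ pathELength I γ 0 1 := by
    apply riemannianEDist_le_pathELength _ _ _ zero_le_one
    · exact (contMDiffOn_extChartAt_symm x).comp η_smooth hη.1
    · simp [γ, η, ContinuousAffineMap.coe_lineMap_eq, h'y]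
    · simp [γ, η, ContinuousAffineMap.coe_lineMap_eq, h'z]
  apply this.trans
  rw [← lintegral_fderiv_lineMap_eq_edist, pathELength_eq_lintegral_mfderivWithin_Icc,
    ← lintegral_const_mul' _ _ ENNReal.coe_ne_top]
  apply setLIntegral_mono' measurableSet_Icc (fun t ht ↦ ?_)
  have : mfderiv[Icc 0 1] γ t =
      (mfderiv[range I] (extChartAt I x).symm (η t)) ∘L (mfderiv[Icc 0 1] η t) := by
    apply mfderivWithin_comp
    · exact mdifferentiableWithinAt_extChartAt_symm (hη.1 ht)
    · exact η_smooth.mdifferentiableOn one_ne_zero t ht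
    · exact hη.1.trans (preimage_mono (extChartAt_target_subset_range x))
    · rw [uniqueMDiffWithinAt_iff_uniqueDiffWithinAt]
      exact uniqueDiffOn_Icc zero_lt_one t ht
  have : mfderiv[Icc 0 1] γ t 1 =
      (mfderiv[range I] (extChartAt I x).symm (η t)) (mfderiv[Icc 0 1] η t 1) := congr($this 1)
  rw [this]
  refine (hη.2 ht _).trans (le_of_eq ?_)
  rw [mfderivWithin_eq_fderivWithin]
  rfl

/-- The distance in the chart of two points near `x` is controlled by their Riemannian distance. -/
theorem eventually_edist_extChartAt_le_edist (x : M) :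
    ∃ C : ℝ≥0, ∃ V ∈ 𝓝 x, ∀ y ∈ V, ∀ z ∈ V,
      edist (extChartAt I x y) (extChartAt I x z) ≤ C * edist y z := by
  rcases eventually_enorm_mfderiv_extChartAt_apply_le I x with ⟨C, hC⟩
  obtain ⟨ε, hε, hball⟩ := EMetric.mem_nhds_iff.1 (inter_mem hC (extChartAt_source_mem_nhds (I := I) x))
  have hε3 : 0 < ε / 3 := ENNReal.div_pos hε.ne' (by simp)
  have hsum : ε / 3 + ε / 3 + ε / 3 = ε := ENNReal.add_thirds ε
  -- Points of the ε/3-ball are less than 2ε/3 apart, so a nearly minimizing curve between them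
  -- stays in the ε-ball, where the derivative bound holds.
  refine ⟨C, _, Metric.eball_mem_nhds x hε3, fun y hy z hz => ?_⟩
  have hyz : edist y z < ε / 3 + ε / 3 :=
    (edist_triangle_right y z x).trans_lt (ENNReal.add_lt_add hy hz)
  suffices H : ∀ r, edist y z < r → r ≤ ε / 3 + ε / 3 →
      edist (extChartAt I x y) (extChartAt I x z) ≤ C * r by
    have hlim : Tendsto (fun r : ENNReal => C * r) (𝓝[>] edist y z) (𝓝 (C * edist y z)) :=
      (ENNReal.Tendsto.const_mul tendsto_id (Or.inr ENNReal.coe_ne_top)).mono_left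
        nhdsWithin_le_nhds
    have : (𝓝[>] edist y z).NeBot := nhdsGT_neBot_of_exists_gt ⟨_, hyz⟩
    refine ge_of_tendsto hlim ?_
    filter_upwards [Ioc_mem_nhdsGT hyz] with r hr using H r hr.1 hr.2
  intro r hr hrε
  rw [IsRiemannianManifold.out (I := I) y z] at hr
  rcases exists_lt_locally_constant_of_riemannianEDist_lt hr zero_lt_one
    with ⟨γ, hγy, hγz, γ_smooth, hγ, -⟩
  have hmem : ∀ t ∈ Icc (0 : ℝ) 1, γ t ∈ {y | ∀ v : TangentSpace I y,
      @enorm E _ (mfderiv I 𝓘(ℝ, E) (extChartAt I x) y v) ≤ C * ‖v‖ₑ} ∩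
      (extChartAt I x).source := by
    intro t ht
    apply hball
    have h1 : edist y (γ t) ≤ pathELength I γ 0 1 := by
      rw [IsRiemannianManifold.out (I := I)]
      exact (riemannianEDist_le_pathELength γ_smooth.contMDiffOn hγy rfl ht.1).trans
        (pathELength_mono le_rfl ht.2)
    rw [Metric.mem_eball, edist_comm]
    calc edist x (γ t) ≤ edist x y + edist y (γ t) := edist_triangle _ _ _
      _ < ε / 3 + (ε / 3 + ε / 3) := by
        refine ENNReal.add_lt_add (by rwa [edist_comm]) (h1.trans_lt (hγ.trans_le hrε))
      _ = ε := by rw [← add_assoc, hsum]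
  let γ' := extChartAt I x ∘ γ
  have hsrc : ∀ t ∈ Icc (0 : ℝ) 1, γ t ∈ (chartAt H x).source := fun t ht => by
    simpa using (hmem t ht).2
  have hC' : CMDiff[Icc 0 1] 1 γ' :=
    contMDiffOn_extChartAt.comp (I' := I) (t := (chartAt H x).source)
      γ_smooth.contMDiffOn hsrc
  have h01 : edist (extChartAt I x y) (extChartAt I x z) = ‖γ' 1 - γ' 0‖ₑ := by
    rw [edist_comm, edist_eq_enorm_sub]
    simp [γ', hγy, hγz]
  rw [h01]
  calc
    ‖γ' 1 - γ' 0‖ₑ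
    _ ≤ ∫⁻ t' in Icc 0 1, ‖derivWithin γ' (Icc 0 1) t'‖ₑ := by
      apply enorm_sub_le_lintegral_derivWithin_Icc_of_contDiffOn_Icc _ zero_le_one
      rwa [← contMDiffOn_iff_contDiffOn]
    _ ≤ ∫⁻ t' in Icc 0 1, C * ‖mfderiv[Icc 0 1] γ t' 1‖ₑ := by
      apply setLIntegral_mono' measurableSet_Icc (fun t' ht' ↦ ?_)
      have h1 : mfderiv[Icc 0 1] γ' t' =
          (mfderiv% (extChartAt I x) (γ t')) ∘L (mfderiv[Icc 0 1] γ t') := by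
        apply mfderiv_comp_mfderivWithin
        · exact mdifferentiableAt_extChartAt (hsrc t' ht')
        · exact (γ_smooth.mdifferentiable one_ne_zero).mdifferentiableOn _ ht'
        · rw [uniqueMDiffWithinAt_iff_uniqueDiffWithinAt]
          exact uniqueDiffOn_Icc zero_lt_one _ ht'
      have h2 : derivWithin γ' (Icc 0 1) t' =
          (mfderiv% (extChartAt I x) (γ t')) (mfderiv[Icc 0 1] γ t' 1) := by
        rw [← fderivWithin_derivWithin, ← mfderivWithin_eq_fderivWithin]
        exact congr($h1 1)
      rw [h2]
      exact (hmem t' ht').1 _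
    _ = C * pathELength I γ 0 1 := by
      rw [lintegral_const_mul' _ _ ENNReal.coe_ne_top,
          pathELength_eq_lintegral_mfderivWithin_Icc]
    _ ≤ C * r := by gcongr

end RiemannianCharts

/-! ### Continuous convergence on compact spaces. -/

section CompactLimits

/-- The tube lemma for filters, used to turn local eventual statements into uniform ones. -/
theorem IsCompact.eventually_forall_of_prod {ι X : Type*} [TopologicalSpace X] {l : Filter ι}
    {K : Set X} (hK : IsCompact K) {P : ι → X → Prop}
    (h : ∀ x ∈ K, ∀ᶠ z : ι × X in l ×ˢ 𝓝 x, P z.1 z.2) : ∀ᶠ i in l, ∀ x ∈ K, P i x := by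
  have hmem : {z : ι × X | P z.1 z.2} ∈ l ×ˢ 𝓝ˢ K := hK.mem_prod_nhdsSet_of_forall h
  obtain ⟨pa, ha, pb, hb, hab⟩ := eventually_prod_iff.1 hmem
  filter_upwards [ha] with i hi x hx
  exact hab hi (subset_of_mem_nhdsSet hb hx)

variable {ι X Y : Type*} [TopologicalSpace X] [TopologicalSpace Y] {l : Filter ι}

/-- Continuous convergence implies convergence in the compact-open topology. -/
theorem ContinuousMap.tendsto_of_forall_tendsto_prod {g : ι → C(X, Y)} {f : C(X, Y)}
    (h : ∀ x, Tendsto (fun z : ι × X => g z.1 z.2) (l ×ˢ 𝓝 x) (𝓝 (f x))) :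
    Tendsto g l (𝓝 f) := by
  rw [ContinuousMap.tendsto_nhds_compactOpen]
  intro K hK U hU hfU
  exact hK.eventually_forall_of_prod fun x hx => h x (hU.mem_nhds (hfU hx))

/-- A continuously convergent family of uniformly locally injective maps on a compact space is
eventually injective if its limit is injective. -/
theorem eventually_injective_of_forall_tendsto_prod [CompactSpace X] [T2Space Y] {g : ι → X → Y}
    {f : X → Y} (hf : Function.Injective f)
    (h : ∀ x, Tendsto (fun z : ι × X => g z.1 z.2) (l ×ˢ 𝓝 x) (𝓝 (f x)))
    (hloc : ∀ x, ∃ U ∈ 𝓝 x, ∀ᶠ i in l, InjOn (g i) U) : ∀ᶠ i in l, Function.Injective (g i) := by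
  have key : ∀ᶠ i in l, ∀ p ∈ (univ : Set (X × X)), g i p.1 = g i p.2 → p.1 = p.2 := by
    refine isCompact_univ.eventually_forall_of_prod ?_
    rintro ⟨x, y⟩ -
    rw [nhds_prod_eq]
    -- Near the diagonal local injectivity applies. Off it, disjoint neighbourhoods of the distinct
    -- limits separate the values.
    by_cases hxy : x = y
    · subst hxy
      obtain ⟨U, hU, hi⟩ := hloc x
      filter_upwards [hi.prod_mk (prod_mem_prod hU hU)] with z hz hzz
      exact hz.1 hz.2.1 hz.2.2 hzz
    · obtain ⟨u, v, hu, hv, hxu, hyv, huv⟩ := t2_separation (hf.ne hxy)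
      have h1 := (h x).eventually (hu.mem_nhds hxu)
      have h2 := (h y).eventually (hv.mem_nhds hyv)
      have t1 : Tendsto (fun z : ι × X × X => (z.1, z.2.1)) (l ×ˢ (𝓝 x ×ˢ 𝓝 y)) (l ×ˢ 𝓝 x) :=
        tendsto_fst.prodMk (tendsto_fst.comp tendsto_snd)
      have t2 : Tendsto (fun z : ι × X × X => (z.1, z.2.2)) (l ×ˢ (𝓝 x ×ˢ 𝓝 y)) (l ×ˢ 𝓝 y) :=
        tendsto_fst.prodMk (tendsto_snd.comp tendsto_snd)
      filter_upwards [t1.eventually h1, t2.eventually h2] with z hz1 hz2 hzz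
      exact absurd hzz (huv.ne_of_mem hz1 hz2)
  filter_upwards [key] with i hi x y hxy using hi (x, y) (mem_univ _) hxy

end CompactLimits

/-! ### Coercivity on manifolds, independent of charts. -/

section ManifoldCoercive

variable {E : Type*} [NormedAddCommGroup E] [NormedSpace ℝ E]
  {M : Type*} [TopologicalSpace M] [ChartedSpace E M] [IsManifold 𝓘(ℝ, E) ∞ M]
  {N : Type*} [TopologicalSpace N] [ChartedSpace E N] [IsManifold 𝓘(ℝ, E) ∞ N]

theorem contDiffAt_coordChange {a b x : M} (ha : x ∈ (chartAt E a).source)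
    (hb : x ∈ (chartAt E b).source) :
    ContDiffAt ℝ ∞ (chartAt E b ∘ (chartAt E a).symm) (chartAt E a x) := by
  rw [← contMDiffAt_iff_contDiffAt]
  have h1 : ContMDiffAt 𝓘(ℝ, E) 𝓘(ℝ, E) ∞ (chartAt E a).symm (chartAt E a x) :=
    contMDiffOn_chart_symm.contMDiffAt
      ((chartAt E a).open_target.mem_nhds ((chartAt E a).map_source ha))
  have h2 : ContMDiffAt 𝓘(ℝ, E) 𝓘(ℝ, E) ∞ (chartAt E b) ((chartAt E a).symm (chartAt E a x)) := by
    rw [(chartAt E a).left_inv ha]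
    exact contMDiffOn_chart.contMDiffAt ((chartAt E b).open_source.mem_nhds hb)
  exact h2.comp _ h1

/-- The two opposite coordinate changes compose to the identity near the point, so by the chain rule
their derivatives are mutually inverse. -/
theorem exists_hasStrictFDerivAt_coordChange {a b x : M} (ha : x ∈ (chartAt E a).source)
    (hb : x ∈ (chartAt E b).source) :
    ∃ B : E ≃L[ℝ] E, HasStrictFDerivAt (chartAt E b ∘ (chartAt E a).symm) (B : E →L[ℝ] E)
      (chartAt E a x) := by
  have key : ∀ a b : M, x ∈ (chartAt E a).source → x ∈ (chartAt E b).source →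
      ∀ A B : E →L[ℝ] E,
      HasStrictFDerivAt (chartAt E b ∘ (chartAt E a).symm) A (chartAt E a x) →
      HasStrictFDerivAt (chartAt E a ∘ (chartAt E b).symm) B (chartAt E b x) →
      ∀ v, B (A v) = v := by
    intro a b ha hb A B hA hB v
    have hB' : HasFDerivAt (chartAt E a ∘ (chartAt E b).symm) B
        ((chartAt E b ∘ (chartAt E a).symm) (chartAt E a x)) := by
      rw [Function.comp_apply, (chartAt E a).left_inv ha]
      exact hB.hasFDerivAt
    have hcomp := hB'.comp _ hA.hasFDerivAt
    have hid : (chartAt E a ∘ (chartAt E b).symm) ∘ (chartAt E b ∘ (chartAt E a).symm)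
        =ᶠ[𝓝 (chartAt E a x)] id := by
      have hc : ContinuousAt (chartAt E a).symm (chartAt E a x) :=
        (chartAt E a).continuousAt_symm ((chartAt E a).map_source ha)
      have hb' : (chartAt E b).source ∈ 𝓝 ((chartAt E a).symm (chartAt E a x)) := by
        rw [(chartAt E a).left_inv ha]
        exact (chartAt E b).open_source.mem_nhds hb
      filter_upwards [hc hb', (chartAt E a).open_target.mem_nhds ((chartAt E a).map_source ha)]
        with q hq hq'
      simp only [Function.comp_apply, id]
      rw [(chartAt E b).left_inv hq, (chartAt E a).right_inv hq']
    have := (hasFDerivAt_id _).unique (hcomp.congr_of_eventuallyEq hid.symm)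
    exact congr($this.symm v)
  have h1 := (contDiffAt_coordChange ha hb).hasStrictFDerivAt (by simp)
  have h2 := (contDiffAt_coordChange hb ha).hasStrictFDerivAt (by simp)
  exact ⟨ContinuousLinearEquiv.equivOfInverse _ _ (key a b ha hb _ _ h1 h2)
    (key b a hb ha _ _ h2 h1), h1⟩

/-- A map between manifolds is coercive at `x` if its expression in the preferred charts is. -/
def MCoerciveAt (f : M → N) (x : M) : Prop :=
  CoerciveAt (chartAt E (f x) ∘ f ∘ (chartAt E x).symm) (chartAt E x x)

theorem coerciveAt_chart_change {f : M → N} {x : M} (hf : ContinuousAt f x) {a a' : M} {b b' : N}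
    (ha : x ∈ (chartAt E a).source) (ha' : x ∈ (chartAt E a').source)
    (hb : f x ∈ (chartAt E b).source) (hb' : f x ∈ (chartAt E b').source)
    (H : CoerciveAt (chartAt E b ∘ f ∘ (chartAt E a).symm) (chartAt E a x)) :
    CoerciveAt (chartAt E b' ∘ f ∘ (chartAt E a').symm) (chartAt E a' x) := by
  obtain ⟨A, hA⟩ := exists_hasStrictFDerivAt_coordChange ha' ha
  obtain ⟨B, hB⟩ := exists_hasStrictFDerivAt_coordChange hb hb'
  have e1 : (chartAt E a ∘ (chartAt E a').symm) (chartAt E a' x) = chartAt E a x := by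
    rw [Function.comp_apply, (chartAt E a').left_inv ha']
  have e2 : (chartAt E b ∘ f ∘ (chartAt E a).symm) (chartAt E a x) = chartAt E b (f x) := by
    simp only [Function.comp_apply]; rw [(chartAt E a).left_inv ha]
  have H1 := H.comp_left (ψ := chartAt E b' ∘ (chartAt E b).symm) (B := B) (by rw [e2]; exact hB)
  rw [← e1] at H1
  refine (H1.comp_right hA).congr ?_
  have hc : ContinuousAt (chartAt E a').symm (chartAt E a' x) :=
    (chartAt E a').continuousAt_symm ((chartAt E a').map_source ha')
  have n1 : (chartAt E a).source ∩ f ⁻¹' (chartAt E b).source ∈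
      𝓝 ((chartAt E a').symm (chartAt E a' x)) := by
    rw [(chartAt E a').left_inv ha']
    exact inter_mem ((chartAt E a).open_source.mem_nhds ha)
      (hf ((chartAt E b).open_source.mem_nhds hb))
  filter_upwards [hc n1] with q hq
  simp only [Function.comp_apply]
  rw [(chartAt E a).left_inv hq.1, (chartAt E b).left_inv hq.2]

theorem mCoerciveAt_iff {f : M → N} {x : M} (hf : ContinuousAt f x) {a : M} {b : N}
    (ha : x ∈ (chartAt E a).source) (hb : f x ∈ (chartAt E b).source) :
    MCoerciveAt (E := E) f x ↔
      CoerciveAt (chartAt E b ∘ f ∘ (chartAt E a).symm) (chartAt E a x) :=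
  ⟨coerciveAt_chart_change hf (mem_chart_source E x) ha (mem_chart_source E (f x)) hb,
    coerciveAt_chart_change hf ha (mem_chart_source E x) hb (mem_chart_source E (f x))⟩

theorem MCoerciveAt.congr {f g : M → N} {x : M} (H : MCoerciveAt (E := E) f x)
    (hg : g =ᶠ[𝓝 x] f) : MCoerciveAt (E := E) g x := by
  unfold MCoerciveAt
  rw [hg.eq_of_nhds]
  refine CoerciveAt.congr H ?_
  have hc : ContinuousAt (chartAt E x).symm (chartAt E x x) :=
    (chartAt E x).continuousAt_symm (mem_chart_target E x)
  have hg' : ∀ᶠ y in 𝓝 ((chartAt E x).symm (chartAt E x x)), g y = f y := by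
    rw [(chartAt E x).left_inv (mem_chart_source E x)]; exact hg
  filter_upwards [hc.eventually hg'] with q hq
  simp only [Function.comp_apply, hq]

theorem contMDiffAt_iff_chart {f : M → N} {x : M} (hf : ContinuousAt f x) {a : M} {b : N}
    (ha : x ∈ (chartAt E a).source) (hb : f x ∈ (chartAt E b).source) :
    ContMDiffAt 𝓘(ℝ, E) 𝓘(ℝ, E) ∞ f x ↔
      ContDiffAt ℝ ∞ (chartAt E b ∘ f ∘ (chartAt E a).symm) (chartAt E a x) := by
  rw [contMDiffAt_iff_of_mem_source ha hb]
  simp [hf, extChartAt, contDiffWithinAt_univ, OpenPartialHomeomorph.extend]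

end ManifoldCoercive

/-! ### Global smoothing and the diffeomorphism. -/

section ManifoldSmoothing

variable {E : Type*} [NormedAddCommGroup E] [NormedSpace ℝ E] [FiniteDimensional ℝ E]
  {M : Type*} [TopologicalSpace M] [CompactSpace M] [T2Space M] [ChartedSpace E M]
  [IsManifold 𝓘(ℝ, E) ∞ M]
  {N : Type*} [TopologicalSpace N] [T2Space N] [ChartedSpace E N] [IsManifold 𝓘(ℝ, E) ∞ N]

/-- Around every point there is a neighbourhood on which all coercive injective maps close to `F`
can be smoothed. -/
theorem exists_nhds_smoothing (F : C(M, N)) (x₀ : M) :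
    ∃ K ∈ 𝓝 x₀, ∃ W : Set C(M, N), IsOpen W ∧ F ∈ W ∧ ∀ f ∈ W,
      (∀ x, MCoerciveAt (E := E) f x) → Function.Injective f → ∀ W' ∈ 𝓝 f, ∃ g ∈ W',
        (∀ x, MCoerciveAt (E := E) g x) ∧ Function.Injective g ∧
        (∀ x, ContMDiffAt 𝓘(ℝ, E) 𝓘(ℝ, E) ∞ f x → ContMDiffAt 𝓘(ℝ, E) 𝓘(ℝ, E) ∞ g x) ∧
        ∀ x ∈ K, ContMDiffAt 𝓘(ℝ, E) 𝓘(ℝ, E) ∞ g x := by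
  classical
  borelize E
  set φ := chartAt E x₀ with hφ
  set ψ := chartAt E (F x₀) with hψ
  set p₀ := φ x₀ with hp₀
  have hx₀ : x₀ ∈ φ.source := mem_chart_source E x₀
  have hp₀t : p₀ ∈ φ.target := mem_chart_target E x₀
  -- The result is smooth on radius r, the map changes only within 2r, and both charts are under
  -- control up to 3r.
  obtain ⟨r, hr, hrsub⟩ : ∃ r > 0, Metric.closedBall p₀ (3 * r) ⊆
      φ.target ∩ φ.symm ⁻¹' (F ⁻¹' ψ.source) := by
    have : φ.target ∩ φ.symm ⁻¹' (F ⁻¹' ψ.source) ∈ 𝓝 p₀ := by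
      refine inter_mem (φ.open_target.mem_nhds hp₀t) (φ.continuousAt_symm hp₀t ?_)
      rw [φ.left_inv hx₀]
      exact F.continuous.continuousAt (ψ.open_source.mem_nhds (mem_chart_source E (F x₀)))
    obtain ⟨ε, hε, hsub⟩ := Metric.nhds_basis_closedBall.mem_iff.1 this
    exact ⟨ε / 3, by positivity, by rwa [mul_div_cancel₀ _ (by norm_num)]⟩
  have hBt : Metric.closedBall p₀ (3 * r) ⊆ φ.target := fun q hq => (hrsub hq).1
  have hcomp : ∀ t ≤ 3 * r, IsCompact (φ.symm '' Metric.closedBall p₀ t) := fun t ht =>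
    (isCompact_closedBall p₀ t).image_of_continuousOn
      (φ.continuousOn_symm.mono ((Metric.closedBall_subset_closedBall ht).trans hBt))
  have hnhds : ∀ t > 0, φ.source ∩ φ ⁻¹' Metric.ball p₀ t ∈ 𝓝 x₀ := fun t ht =>
    inter_mem (φ.open_source.mem_nhds hx₀)
      (φ.continuousAt hx₀ (Metric.ball_mem_nhds _ ht))
  have hopen : ∀ t, IsOpen (φ.source ∩ φ ⁻¹' Metric.ball p₀ t) := fun t =>
    φ.isOpen_inter_preimage Metric.isOpen_ball
  -- This open condition lets the same two charts serve every f in W, whatever was modified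
  -- elsewhere.
  refine ⟨_, hnhds r hr, {f | MapsTo f (φ.symm '' Metric.closedBall p₀ (3 * r)) ψ.source},
    ContinuousMap.isOpen_setOfPred_mapsTo (hcomp _ le_rfl) ψ.open_source, ?_, ?_⟩
  · rintro _ ⟨q, hq, rfl⟩
    exact (hrsub hq).2
  intro f hfW hfco hfinj W' hW'
  have hfW' : ∀ q ∈ Metric.closedBall p₀ (3 * r), f (φ.symm q) ∈ ψ.source := fun q hq =>
    hfW (mem_image_of_mem _ hq)
  set O := φ.source ∩ φ ⁻¹' Metric.ball p₀ (3 * r) with hO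
  have hOopen : IsOpen O := hopen _
  have hOf : ∀ x ∈ O, f x ∈ ψ.source := fun x hx => by
    have := hfW' (φ x) (Metric.ball_subset_closedBall hx.2)
    rwa [φ.left_inv hx.1] at this
  set C₂ := φ.symm '' Metric.closedBall p₀ (2 * r) with hC₂
  have hC₂closed : IsClosed C₂ := (hcomp _ (by linarith)).isClosed
  -- The open sets O and C₂ᶜ cover M. On O the new map has a chart formula and off C₂ it equals f,
  -- so local properties are checked in these two cases.
  have hC₂O : ∀ x, x ∈ O ∨ x ∉ C₂ := by
    intro x
    by_cases hx : x ∈ C₂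
    · left
      obtain ⟨q, hq, rfl⟩ := hx
      have hqt : q ∈ φ.target := hBt (Metric.closedBall_subset_closedBall (by linarith) hq)
      refine ⟨φ.map_target hqt, ?_⟩
      rw [mem_preimage, φ.right_inv hqt]
      exact Metric.closedBall_subset_ball (by linarith) hq
    · exact Or.inr hx
  set h : E → E := ψ ∘ f ∘ φ.symm with hh
  have hhc : ContinuousOn h (Metric.closedBall p₀ (3 * r)) :=
    ψ.continuousOn.comp (f.continuous.comp_continuousOn (φ.continuousOn_symm.mono hBt)) hfW'
  have hhco : ∀ p ∈ Metric.ball p₀ (3 * r), CoerciveAt h p := by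
    intro p hp
    have hpB := Metric.ball_subset_closedBall hp
    have := (mCoerciveAt_iff (a := x₀) (b := F x₀) f.continuous.continuousAt
      (φ.map_target (hBt hpB)) (hfW' p hpB)).1 (hfco (φ.symm p))
    rwa [← hφ, φ.right_inv (hBt hpB)] at this
  obtain ⟨k, hk1, hk2, hk3, hk4, hk5, hk6⟩ := exists_smoothing hr hhc hhco
  have hht : ∀ q ∈ Metric.closedBall p₀ (3 * r), h q ∈ ψ.target := fun q hq =>
    ψ.map_source (hfW' q hq)
  have hkt : ∀ᶠ j in atTop, ∀ q ∈ Metric.closedBall p₀ (3 * r), k j q ∈ ψ.target := by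
    obtain ⟨δ, hδ, hsub⟩ := ((isCompact_closedBall p₀ (3 * r)).image_of_continuousOn
      hhc).exists_thickening_subset_open ψ.open_target (image_subset_iff.2 hht)
    filter_upwards [Metric.tendstoUniformlyOn_iff.1 hk3 δ hδ] with j hj q hq
    exact hsub (Metric.mem_thickening_iff.2 ⟨h q, mem_image_of_mem _ hq, by
      rw [dist_comm]; exact hj q hq⟩)
  have hkco : ∀ᶠ j in atTop, ∀ q ∈ Metric.closedBall p₀ (2 * r), CoerciveAt (k j) q := by
    refine (isCompact_closedBall p₀ (2 * r)).eventually_forall_of_prod fun p hp => ?_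
    obtain ⟨C, U, hU, hj⟩ := hk6 p (Metric.closedBall_subset_ball (by linarith) hp)
    filter_upwards [hj.prod_mk (eventually_mem_nhds_iff.2 hU)] with z hz
    exact ⟨C, U, hz.2, hz.1⟩
  let g : ℕ → M → N := fun j x => if x ∈ O then ψ.symm (k j (φ x)) else f x
  have hgO : ∀ j, ∀ x ∈ O, g j x = ψ.symm (k j (φ x)) := fun j x hx => if_pos hx
  have hgC : ∀ j, ∀ x ∉ C₂, g j x = f x := by
    intro j x hx
    by_cases hxO : x ∈ O
    · have hq : φ x ∉ Metric.ball p₀ (2 * r) := fun hq =>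
        hx ⟨φ x, Metric.ball_subset_closedBall hq, φ.left_inv hxO.1⟩
      rw [hgO j x hxO, hk1 j _ hq]
      simp only [hh, Function.comp_apply]
      rw [φ.left_inv hxO.1, ψ.left_inv (hOf x hxO)]
    · exact if_neg hxO
  have hgCe : ∀ j, ∀ x ∉ C₂, g j =ᶠ[𝓝 x] f := fun j x hx => by
    filter_upwards [hC₂closed.isOpen_compl.mem_nhds hx] with y hy using hgC j y hy
  have hballO : ∀ x ∈ O, φ x ∈ Metric.closedBall p₀ (3 * r) := fun x hx =>
    Metric.ball_subset_closedBall hx.2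
  have hgcont : ∀ᶠ j in atTop, Continuous (g j) := by
    filter_upwards [hkt] with j hj
    rw [continuous_iff_continuousAt]
    intro x
    rcases hC₂O x with hx | hx
    · have hc : ContinuousOn (fun x => ψ.symm (k j (φ x))) O :=
        ψ.continuousOn_symm.comp ((hk2 j).comp (φ.continuousOn.mono inter_subset_left) hballO)
          fun y hy => hj _ (hballO y hy)
      exact (hc.congr (hgO j)).continuousAt (hOopen.mem_nhds hx)
    · exact f.continuous.continuousAt.congr (hgCe j x hx).symm
  have hgtend : ∀ x, Tendsto (fun z : ℕ × M => g z.1 z.2) (atTop ×ˢ 𝓝 x) (𝓝 (f x)) := by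
    intro x
    rcases hC₂O x with hx | hx
    · have hφx : Metric.closedBall p₀ (3 * r) ∈ 𝓝 (φ x) :=
        mem_of_superset (Metric.isOpen_ball.mem_nhds hx.2) Metric.ball_subset_closedBall
      have h1 : Tendsto (fun z : ℕ × E => k z.1 z.2) (atTop ×ˢ 𝓝 (φ x)) (𝓝 (h (φ x))) := by
        refine tendsto_comp_of_locally_uniform_limit_within (s := univ)
          (F := fun z : ℕ × E => k z.1) (g := Prod.snd)
          (hhc.continuousAt hφx).continuousWithinAt (by rw [nhdsWithin_univ]; exact tendsto_snd) ?_
        intro u hu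
        rw [nhdsWithin_univ]
        exact ⟨_, hφx, (hk3 u hu).prod_inl _⟩
      have h2 : Tendsto (fun z : ℕ × M => k z.1 (φ z.2)) (atTop ×ˢ 𝓝 x) (𝓝 (h (φ x))) :=
        h1.comp (tendsto_fst.prodMk ((φ.continuousAt hx.1).tendsto.comp tendsto_snd))
      have h3 := (ψ.continuousAt_symm (hht _ (hballO x hx))).tendsto.comp h2
      have h4 : ψ.symm (h (φ x)) = f x := by
        simp only [hh, Function.comp_apply]
        rw [φ.left_inv hx.1, ψ.left_inv (hOf x hx)]
      rw [h4] at h3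
      refine h3.congr' ?_
      filter_upwards [(eventually_of_mem (hOopen.mem_nhds hx) fun y hy => hy).prod_inr atTop]
        with z hz
      exact (hgO z.1 z.2 hz).symm
    · refine (f.continuous.continuousAt.tendsto.comp tendsto_snd).congr' ?_
      filter_upwards [(eventually_of_mem (hC₂closed.isOpen_compl.mem_nhds hx)
        fun y hy => hy).prod_inr atTop] with z hz
      exact (hgC z.1 z.2 hz).symm
  have hginj : ∀ᶠ j in atTop, Function.Injective (g j) := by
    refine eventually_injective_of_forall_tendsto_prod hfinj hgtend fun x => ?_
    rcases hC₂O x with hx | hx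
    · obtain ⟨C, U, hU, hj⟩ := hk6 (φ x) hx.2
      refine ⟨O ∩ φ ⁻¹' U, inter_mem (hOopen.mem_nhds hx) (φ.continuousAt hx.1 hU), ?_⟩
      filter_upwards [hj, hkt] with j hj hjt y hy z hz hyz
      rw [hgO j y hy.1, hgO j z hz.1] at hyz
      have h1 := ψ.symm.injOn (hjt _ (hballO y hy.1)) (hjt _ (hballO z hz.1)) hyz
      exact φ.injOn hy.1.1 hz.1.1 (hj.injOn hy.2 hz.2 h1)
    · refine ⟨C₂ᶜ, hC₂closed.isOpen_compl.mem_nhds hx, Eventually.of_forall fun j y hy z hz hyz => ?_⟩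
      rw [hgC j y hy, hgC j z hz] at hyz
      exact hfinj hyz
  -- Continuity holds only for large j; the default f is irrelevant in the limit.
  let G : ℕ → C(M, N) := fun j => if hc : Continuous (g j) then ⟨g j, hc⟩ else f
  have hG : ∀ᶠ j in atTop, (G j : M → N) = g j := by
    filter_upwards [hgcont] with j hj
    simp only [G, dif_pos hj, ContinuousMap.coe_mk]
  have hGtend : Tendsto G atTop (𝓝 f) := by
    refine ContinuousMap.tendsto_of_forall_tendsto_prod fun x => (hgtend x).congr' ?_
    filter_upwards [hG.prod_inl (𝓝 x)] with z hz
    rw [hz]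
  obtain ⟨j, hjW, hjG, hjc, hji, hjt, hjco⟩ :=
    ((hGtend.eventually hW').and (hG.and (hgcont.and (hginj.and (hkt.and hkco))))).exists
  have hloc : ∀ x ∈ O, g j x ∈ ψ.source ∧ ψ ∘ g j ∘ φ.symm =ᶠ[𝓝 (φ x)] k j := by
    intro x hx
    refine ⟨by rw [hgO j x hx]; exact ψ.map_target (hjt _ (hballO x hx)), ?_⟩
    filter_upwards [Metric.isOpen_ball.mem_nhds hx.2] with q hq
    have hqB := Metric.ball_subset_closedBall hq
    have hqO : φ.symm q ∈ O := ⟨φ.map_target (hBt hqB), by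
      rw [mem_preimage, φ.right_inv (hBt hqB)]; exact hq⟩
    simp only [Function.comp_apply]
    rw [hgO j _ hqO, φ.right_inv (hBt hqB), ψ.right_inv (hjt q hqB)]
  refine ⟨G j, hjW, ?_, ?_, ?_, ?_⟩ <;> rw [hjG]
  · intro x
    by_cases hx : x ∈ C₂
    · have hxO : x ∈ O := (hC₂O x).resolve_right (not_not.2 hx)
      rw [mCoerciveAt_iff hjc.continuousAt (a := x₀) (b := F x₀) hxO.1 (hloc x hxO).1]
      refine (hjco (φ x) ?_).congr (hloc x hxO).2
      obtain ⟨q, hq, rfl⟩ := hx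
      rwa [φ.right_inv (hBt (Metric.closedBall_subset_closedBall (by linarith) hq))]
    · exact (hfco x).congr (hgCe j x hx)
  · exact hji
  · intro x hfx
    rcases hC₂O x with hx | hx
    · rw [contMDiffAt_iff_chart hjc.continuousAt (a := x₀) (b := F x₀) hx.1 (hloc x hx).1]
      rw [contMDiffAt_iff_chart f.continuous.continuousAt (a := x₀) (b := F x₀) hx.1
        (hOf x hx)] at hfx
      exact (hk5 j _ hfx).congr_of_eventuallyEq (hloc x hx).2
    · exact hfx.congr_of_eventuallyEq (hgCe j x hx)
  · intro x hx
    have hxO : x ∈ O := ⟨hx.1, Metric.ball_subset_ball (by linarith) hx.2⟩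
    rw [contMDiffAt_iff_chart hjc.continuousAt (a := x₀) (b := F x₀) hxO.1 (hloc x hxO).1]
    exact ((hk4 j).contDiffAt (Metric.isOpen_ball.mem_nhds hx.2)).congr_of_eventuallyEq
      (hloc x hxO).2

/-- A coercive injective map from a compact manifold is a limit of smooth ones. -/
theorem exists_contMDiff_mem_nhds (F : C(M, N)) (hF : ∀ x, MCoerciveAt (E := E) F x)
    (hinj : Function.Injective F) {W' : Set C(M, N)} (hW' : W' ∈ 𝓝 F) :
    ∃ g ∈ W', (∀ x, MCoerciveAt (E := E) g x) ∧ Function.Injective g ∧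
      ContMDiff 𝓘(ℝ, E) 𝓘(ℝ, E) ∞ g := by
  obtain ⟨W, -, hFW, hW⟩ := (isCompact_univ (X := M)).induction_on
    (p := fun K => ∃ W : Set C(M, N), IsOpen W ∧ F ∈ W ∧ ∀ f ∈ W,
      (∀ x, MCoerciveAt (E := E) f x) → Function.Injective f → ∀ W' ∈ 𝓝 f, ∃ g ∈ W',
        (∀ x, MCoerciveAt (E := E) g x) ∧ Function.Injective g ∧
        (∀ x, ContMDiffAt 𝓘(ℝ, E) 𝓘(ℝ, E) ∞ f x → ContMDiffAt 𝓘(ℝ, E) 𝓘(ℝ, E) ∞ g x) ∧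
        ∀ x ∈ K, ContMDiffAt 𝓘(ℝ, E) 𝓘(ℝ, E) ∞ g x)
    ⟨univ, isOpen_univ, mem_univ _, fun f _ hf hfi W' hW' =>
      ⟨f, mem_of_mem_nhds hW', hf, hfi, fun _ h => h, fun _ h => h.elim⟩⟩
    (fun s t hst ⟨W, hW, hFW, H⟩ => ⟨W, hW, hFW, fun f hf hf1 hf2 W' hW' => by
      obtain ⟨g, hg, h1, h2, h3, h4⟩ := H f hf hf1 hf2 W' hW'
      exact ⟨g, hg, h1, h2, h3, fun x hx => h4 x (hst hx)⟩⟩)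
    -- Smooth over s, staying in the open set W₂, then over t. The second step keeps the smoothness
    -- already gained.
    (fun s t ⟨W₁, hW₁, hFW₁, H₁⟩ ⟨W₂, hW₂, hFW₂, H₂⟩ =>
      ⟨W₁ ∩ W₂, hW₁.inter hW₂, ⟨hFW₁, hFW₂⟩, fun f hf hf1 hf2 W' hW' => by
        obtain ⟨g, hg, h1, h2, h3, h4⟩ := H₁ f hf.1 hf1 hf2 (interior W' ∩ W₂)
          (inter_mem (interior_mem_nhds.2 hW') (hW₂.mem_nhds hf.2))
        obtain ⟨g', hg', h1', h2', h3', h4'⟩ := H₂ g hg.2 h1 h2 W'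
          (mem_interior_iff_mem_nhds.1 hg.1)
        exact ⟨g', hg', h1', h2', fun x hx => h3' x (h3 x hx), fun x hx =>
          hx.elim (fun hx => h3' x (h4 x hx)) (h4' x)⟩⟩)
    (fun x _ => by
      obtain ⟨K, hK, H⟩ := exists_nhds_smoothing (E := E) F x
      exact ⟨K, by rwa [nhdsWithin_univ], H⟩)
  obtain ⟨g, hg, h1, h2, -, h4⟩ := hW F hFW hF hinj W' hW'
  exact ⟨g, hg, h1, h2, fun x => h4 x (mem_univ x)⟩

/-- The derivative, in charts, of a smooth coercive map is invertible. -/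
theorem MCoerciveAt.exists_hasStrictFDerivAt {g : M → N} {x : M}
    (hco : MCoerciveAt (E := E) g x) (hg : ContMDiffAt 𝓘(ℝ, E) 𝓘(ℝ, E) ∞ g x) :
    ContDiffAt ℝ ∞ (chartAt E (g x) ∘ g ∘ (chartAt E x).symm) (chartAt E x x) ∧
    ∃ A : E ≃L[ℝ] E, HasStrictFDerivAt (chartAt E (g x) ∘ g ∘ (chartAt E x).symm)
      (A : E →L[ℝ] E) (chartAt E x x) := by
  have hd := (contMDiffAt_iff_chart hg.continuousAt (mem_chart_source E x)
    (mem_chart_source E (g x))).1 hg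
  have hs := hd.hasStrictFDerivAt (by simp)
  have hinj := hco.injective_of_hasFDerivAt hs.hasFDerivAt
  -- Both manifolds are modelled on E, so the derivative is an injective endomorphism in finite
  -- dimension.
  refine ⟨hd, (LinearEquiv.ofInjectiveEndo _ hinj).toContinuousLinearEquiv, ?_⟩
  convert hs using 1
  ext v
  rfl

/-- In charts, an invertible strict derivative sends neighbourhoods to neighbourhoods. -/
theorem isOpen_range_of_mCoerciveAt {g : M → N} (hco : ∀ x, MCoerciveAt (E := E) g x)
    (hg : ContMDiff 𝓘(ℝ, E) 𝓘(ℝ, E) ∞ g) : IsOpen (range g) := by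
  rw [isOpen_iff_mem_nhds]
  rintro _ ⟨x, rfl⟩
  obtain ⟨-, A, hA⟩ := (hco x).exists_hasStrictFDerivAt (hg x)
  set φ := chartAt E x
  set ψ := chartAt E (g x)
  have hx : x ∈ φ.source := mem_chart_source E x
  have hmap := hA.map_nhds_eq_of_equiv
  have hV : φ.symm ⁻¹' (g ⁻¹' ψ.source) ∈ 𝓝 (φ x) := by
    refine φ.continuousAt_symm (φ.map_source hx) ?_
    rw [φ.left_inv hx]
    exact hg.continuous.continuousAt (ψ.open_source.mem_nhds (mem_chart_source E (g x)))
  have him := image_mem_map (m := ψ ∘ g ∘ φ.symm) hV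
  rw [hmap] at him
  have he : (ψ ∘ g ∘ φ.symm) (φ x) = ψ (g x) := by
    simp only [Function.comp_apply]; rw [φ.left_inv hx]
  rw [he] at him
  filter_upwards [ψ.continuousAt (mem_chart_source E (g x)) him,
    ψ.open_source.mem_nhds (mem_chart_source E (g x))] with y hy hy'
  obtain ⟨q, hq, hqy⟩ := hy
  exact ⟨φ.symm q, ψ.injOn hq hy' hqy⟩

/-- A compact manifold and the image of a coercive homeomorphism from it are diffeomorphic. -/
theorem nonempty_diffeomorph_of_mCoerciveAt (F : M ≃ₜ N) (hF : ∀ x, MCoerciveAt (E := E) F x) :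
    Nonempty (M ≃ₘ^∞⟮𝓘(ℝ, E), 𝓘(ℝ, E)⟯ N) := by
  have : LocallyConnectedSpace N := ChartedSpace.locallyConnectedSpace E N
  let F' : C(M, N) := ⟨F, F.continuous⟩
  -- Components of N are open, so closeness to `F` forces g x into the component of F x. This
  -- replaces a degree argument for surjectivity.
  have hW' : {g : C(M, N) | ∀ x ∈ univ, g x ∈ connectedComponent (F x)} ∈ 𝓝 F' := by
    refine isCompact_univ.eventually_forall_of_prod (l := 𝓝 F')
      (P := fun g x => g x ∈ connectedComponent (F x)) fun x _ => ?_
    have hmem : connectedComponent (F x) ∈ 𝓝 (F x) :=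
      isOpen_connectedComponent.mem_nhds mem_connectedComponent
    have h1 : Tendsto (fun z : C(M, N) × M => z.1 z.2) (𝓝 F' ×ˢ 𝓝 x) (𝓝 (F' x)) := by
      rw [← nhds_prod_eq]
      exact continuous_eval.tendsto (F', x)
    have h2 : Tendsto (fun z : C(M, N) × M => F z.2) (𝓝 F' ×ˢ 𝓝 x) (𝓝 (F x)) :=
      F.continuous.continuousAt.tendsto.comp tendsto_snd
    filter_upwards [h1 hmem, h2 hmem] with z hz1 hz2
    rw [← connectedComponent_eq hz2]
    exact hz1
  obtain ⟨g, hgW, hgco, hginj, hg⟩ := exists_contMDiff_mem_nhds F' hF F.injective hW'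
  have hclopen : IsClopen (range g) :=
    ⟨(isCompact_range g.continuous).isClosed, isOpen_range_of_mCoerciveAt hgco hg⟩
  have hsurj : Function.Surjective g := by
    intro y
    have h1 := hgW (F.symm y) (mem_univ _)
    rw [F.apply_symm_apply] at h1
    have h2 := hclopen.connectedComponent_subset (mem_range_self (F.symm y))
    rw [← connectedComponent_eq h1] at h2
    exact h2 mem_connectedComponent
  let e : M ≃ N := Equiv.ofBijective g ⟨hginj, hsurj⟩
  let G : M ≃ₜ N := Continuous.homeoOfEquivCompactToT2 (f := e) g.continuous
  have hGg : ∀ x, G x = g x := fun x => rfl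
  refine ⟨⟨e, hg, ?_⟩⟩
  change ContMDiff 𝓘(ℝ, E) 𝓘(ℝ, E) ∞ G.symm
  intro y
  obtain ⟨x, rfl⟩ := G.surjective y
  obtain ⟨hd, A, hA⟩ := (hgco x).exists_hasStrictFDerivAt (hg x)
  rw [contMDiffAt_iff_chart G.symm.continuous.continuousAt (a := G x) (b := x)
    (mem_chart_source E (G x)) (by rw [G.symm_apply_apply]; exact mem_chart_source E x)]
  set φ := chartAt E x
  set ψ := chartAt E (G x)
  -- The inverse of T is the chart expression of the inverse map, so the inverse function theorem
  -- gives its smoothness.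
  let T : OpenPartialHomeomorph E E := φ.symm ≫ₕ G.toOpenPartialHomeomorph ≫ₕ ψ
  have hx : x ∈ φ.source := mem_chart_source E x
  have hy : G x ∈ ψ.source := mem_chart_source E (G x)
  have hTs : T.symm (ψ (G x)) = φ x := by
    change φ (G.symm (ψ.symm (ψ (G x)))) = φ x
    rw [ψ.left_inv hy, G.symm_apply_apply]
  have hsrc : φ x ∈ T.source := by
    simp only [T, OpenPartialHomeomorph.trans_source, OpenPartialHomeomorph.symm_source,
      Homeomorph.toOpenPartialHomeomorph_source, mem_inter_iff, mem_preimage, univ_inter]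
    refine ⟨φ.map_source hx, ?_⟩
    rw [φ.left_inv hx]
    exact hy
  have htgt : ψ (G x) ∈ T.target := by
    have h1 : T (φ x) = ψ (G x) := by
      change ψ (G (φ.symm (φ x))) = _
      rw [φ.left_inv hx]
    rw [← h1]
    exact T.map_source hsrc
  exact T.contDiffAt_symm htgt (f₀' := A) (by rw [hTs]; exact hA.hasFDerivAt)
    (by rw [hTs]; exact hd)

end ManifoldSmoothing

/-! ### Lipschitz maps in charts and comparison of dimensions. -/

section LipschitzCharts

variable {E : Type*} [NormedAddCommGroup E] [NormedSpace ℝ E]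
  {M : Type*} [EMetricSpace M] [ChartedSpace E M] [IsManifold 𝓘(ℝ, E) 1 M]
  [Bundle.RiemannianBundle (fun x : M => TangentSpace 𝓘(ℝ, E) x)]
  [IsContinuousRiemannianBundle E (fun x : M => TangentSpace 𝓘(ℝ, E) x)]
  [IsRiemannianManifold 𝓘(ℝ, E) M]
  {E' : Type*} [NormedAddCommGroup E'] [NormedSpace ℝ E']
  {N : Type*} [EMetricSpace N] [ChartedSpace E' N] [IsManifold 𝓘(ℝ, E') 1 N]
  [Bundle.RiemannianBundle (fun y : N => TangentSpace 𝓘(ℝ, E') y)]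
  [IsContinuousRiemannianBundle E' (fun y : N => TangentSpace 𝓘(ℝ, E') y)]
  [IsRiemannianManifold 𝓘(ℝ, E') N]

/-- A Lipschitz map between Riemannian manifolds is locally Lipschitz in charts. -/
theorem LipschitzWith.exists_lipschitzOnWith_charts {F : M → N} {K : ℝ≥0} (hF : LipschitzWith K F)
    (x : M) : ∃ L : ℝ≥0, ∃ U ∈ 𝓝 (chartAt E x x),
      LipschitzOnWith L (chartAt E' (F x) ∘ F ∘ (chartAt E x).symm) U := by
  obtain ⟨C₁, V₁, hV₁, h₁⟩ := eventually_edist_le_edist_extChartAt 𝓘(ℝ, E) x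
  obtain ⟨C₂, V₂, hV₂, h₂⟩ := eventually_edist_extChartAt_le_edist 𝓘(ℝ, E') (F x)
  refine ⟨C₂ * (K * C₁), (chartAt E x).target ∩ (chartAt E x).symm ⁻¹' (V₁ ∩ F ⁻¹' V₂), ?_, ?_⟩
  · refine inter_mem ((chartAt E x).open_target.mem_nhds (mem_chart_target E x))
      ((chartAt E x).continuousAt_symm (mem_chart_target E x) ?_)
    rw [(chartAt E x).left_inv (mem_chart_source E x)]
    exact inter_mem hV₁ (hF.continuous.continuousAt hV₂)
  · rintro q ⟨hqt, hq⟩ q' ⟨hqt', hq'⟩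
    have e1 : edist (chartAt E' (F x) (F ((chartAt E x).symm q)))
        (chartAt E' (F x) (F ((chartAt E x).symm q'))) ≤ _ := h₂ _ hq.2 _ hq'.2
    have e2 := hF ((chartAt E x).symm q) ((chartAt E x).symm q')
    have e3 : edist ((chartAt E x).symm q) ((chartAt E x).symm q') ≤
        C₁ * edist (chartAt E x ((chartAt E x).symm q)) (chartAt E x ((chartAt E x).symm q')) :=
      h₁ _ hq.1 _ hq'.1
    rw [(chartAt E x).right_inv hqt, (chartAt E x).right_inv hqt'] at e3
    calc _ ≤ (C₂ : ENNReal) * (K * (C₁ * edist q q')) := by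
          refine e1.trans ?_
          gcongr
          exact e2.trans (by gcongr)
      _ = _ := by push_cast; ring

/-- Lipschitz maps do not raise Hausdorff dimension, and in charts F carries a neighbourhood onto a
neighbourhood. -/
theorem finrank_le_of_lipschitzWith_homeomorph [FiniteDimensional ℝ E] [FiniteDimensional ℝ E']
    (F : M ≃ₜ N) {K : ℝ≥0} (hF : LipschitzWith K F) (x : M) :
    Module.finrank ℝ E' ≤ Module.finrank ℝ E := by
  obtain ⟨L, U, hU, hL⟩ := hF.exists_lipschitzOnWith_charts (E := E) (E' := E') x
  let T : OpenPartialHomeomorph E E' :=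
    (chartAt E x).symm ≫ₕ F.toOpenPartialHomeomorph ≫ₕ chartAt E' (F x)
  have hsrc : chartAt E x x ∈ T.source := by
    simp only [T, OpenPartialHomeomorph.trans_source, OpenPartialHomeomorph.symm_source,
      Homeomorph.toOpenPartialHomeomorph_source, mem_inter_iff, mem_preimage, univ_inter]
    refine ⟨mem_chart_target E x, ?_⟩
    rw [(chartAt E x).left_inv (mem_chart_source E x)]
    exact mem_chart_source E' (F x)
  have him : T '' U ∈ 𝓝 (T (chartAt E x x)) := by
    rw [← T.map_nhds_eq hsrc]
    exact image_mem_map hU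
  have hL' : LipschitzOnWith L T U := hL
  have := hL'.dimH_image_le
  rw [Real.dimH_of_mem_nhds him, Real.dimH_of_mem_nhds hU] at this
  exact_mod_cast this

end LipschitzCharts

/-! ### Smooth metrics are continuous. -/

section SmoothMetric

variable {E : Type*} [NormedAddCommGroup E] [NormedSpace ℝ E]
  {H : Type*} [TopologicalSpace H] {I : ModelWithCorners ℝ E H}
  {M : Type*} [TopologicalSpace M] [ChartedSpace H M]
  {F : Type*} [NormedAddCommGroup F] [NormedSpace ℝ F]
  {V : M → Type*} [TopologicalSpace (Bundle.TotalSpace F V)] [∀ x, NormedAddCommGroup (V x)]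
  [∀ x, InnerProductSpace ℝ (V x)] [FiberBundle F V] [VectorBundle ℝ F V]

theorem IsContMDiffRiemannianBundle.isContinuousRiemannianBundle {k : ℕ∞ω}
    (h : IsContMDiffRiemannianBundle I k F V) : IsContinuousRiemannianBundle F V := by
  obtain ⟨g, hg, hg'⟩ := h.exists_contMDiff
  exact ⟨g, hg.continuous, hg'⟩

end SmoothMetric

/-! ### Clarke limits read in charts. -/

section ClarkeManifold

variable {E : Type*} [NormedAddCommGroup E] [NormedSpace ℝ E]
  {M : Type*} [TopologicalSpace M] [ChartedSpace E M] [IsManifold 𝓘(ℝ, E) 1 M]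
  {E' : Type*} [NormedAddCommGroup E'] [NormedSpace ℝ E']
  {N : Type*} [TopologicalSpace N] [ChartedSpace E' N] [IsManifold 𝓘(ℝ, E') 1 N]

theorem limitFDerivs_subset_limitDifferentials {F : M → N} (hF : Continuous F) (x : M) :
    limitFDerivs (chartAt E' (F x) ∘ F ∘ (chartAt E x).symm) (chartAt E x x) ⊆
      limitDifferentials 𝓘(ℝ, E) 𝓘(ℝ, E') F x := by
  rintro A ⟨q, hq, hqp, hqA⟩
  set φ := chartAt E x with hφ
  set ψ := chartAt E' (F x) with hψ
  have hx : x ∈ φ.source := mem_chart_source E x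
  have hcs : ContinuousAt φ.symm (φ x) := φ.continuousAt_symm (φ.map_source hx)
  have hev : ∀ᶠ i in atTop, q i ∈ φ.target ∧ F (φ.symm (q i)) ∈ ψ.source := by
    have hpre : φ.symm ⁻¹' (F ⁻¹' ψ.source) ∈ 𝓝 (φ x) := by
      refine hcs.preimage_mem_nhds ?_
      rw [φ.left_inv hx]
      exact hF.continuousAt (ψ.open_source.mem_nhds (mem_chart_source E' (F x)))
    exact hqp.eventually (inter_mem (φ.open_target.mem_nhds (φ.map_source hx)) hpre)
  -- Early terms may leave the chart; dropping them does not affect the limits.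
  obtain ⟨n, hn⟩ := eventually_atTop.1 hev
  have hshift : Tendsto (fun i => i + n) atTop atTop := tendsto_add_atTop_nat n
  refine ⟨fun i => φ.symm (q (i + n)), fun i => ?_, ?_, ?_⟩
  · obtain ⟨h1, h2⟩ := hn (i + n) (Nat.le_add_left n i)
    rw [mdifferentiableAt_iff_of_mem_source (φ.map_target h1) h2]
    refine ⟨hF.continuousAt, ?_⟩
    have : DifferentiableAt ℝ (ψ ∘ F ∘ φ.symm) (φ (φ.symm (q (i + n)))) := by
      rw [φ.right_inv h1]; exact hq _
    exact this.differentiableWithinAt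
  · have := hcs.tendsto.comp (hqp.comp hshift)
    rwa [φ.left_inv hx] at this
  · refine (hqA.comp hshift).congr fun i => ?_
    obtain ⟨h1, h2⟩ := hn (i + n) (Nat.le_add_left n i)
    have e : extChartAt 𝓘(ℝ, E) x (φ.symm (q (i + n))) = q (i + n) := φ.right_inv h1
    rw [e, modelWithCornersSelf_coe, range_id, fderivWithin_univ]
    rfl

end ClarkeManifold

/-! ### Maximal rank as injectivity, and the conclusion. -/

theorem injective_of_finrank_range_eq {V V' : Type*} [AddCommGroup V] [Module ℝ V]
    [FiniteDimensional ℝ V] [AddCommGroup V'] [Module ℝ V'] {A : V →ₗ[ℝ] V'}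
    (h : Module.finrank ℝ (LinearMap.range A) = Module.finrank ℝ V) : Function.Injective A := by
  have := A.finrank_range_add_finrank_ker
  rw [← LinearMap.ker_eq_bot, ← Submodule.finrank_eq_zero (R := ℝ)]
  omega

theorem mainTheorem2 {m n : ℕ}
    {M : Type*} [EMetricSpace M] [CompactSpace M]
    [ChartedSpace (EuclideanSpace ℝ (Fin m)) M] [IsManifold (𝓡 m) ∞ M]
    [Bundle.RiemannianBundle (fun x : M => TangentSpace (𝓡 m) x)]
    [IsContMDiffRiemannianBundle (𝓡 m) ∞ (EuclideanSpace ℝ (Fin m))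
      (fun x : M => TangentSpace (𝓡 m) x)]
    [IsRiemannianManifold (𝓡 m) M]
    {N : Type*} [EMetricSpace N]
    [ChartedSpace (EuclideanSpace ℝ (Fin n)) N] [IsManifold (𝓡 n) ∞ N]
    [Bundle.RiemannianBundle (fun y : N => TangentSpace (𝓡 n) y)]
    [IsContMDiffRiemannianBundle (𝓡 n) ∞ (EuclideanSpace ℝ (Fin n))
      (fun y : N => TangentSpace (𝓡 n) y)]
    [IsRiemannianManifold (𝓡 n) N]
    (F : M ≃ₜ N)
    (hF : ∃ K : ℝ≥0, LipschitzWith K F)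
    (hFsymm : ∃ K : ℝ≥0, LipschitzWith K F.symm)
    (hsing : ∀ x : M, IsClarkeNonsingularAt (𝓡 m) (𝓡 n) F x)
    (hsing_symm : ∀ y : N, IsClarkeNonsingularAt (𝓡 n) (𝓡 m) F.symm y) :
    Nonempty (M ≃ₘ^∞⟮𝓡 m, 𝓡 n⟯ N) := by
  have : IsManifold (𝓡 m) 1 M := IsManifold.of_le (n := ∞) (by simp)
  have : IsManifold (𝓡 n) 1 N := IsManifold.of_le (n := ∞) (by simp)
  have : IsContinuousRiemannianBundle (EuclideanSpace ℝ (Fin m))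
      (fun x : M => TangentSpace (𝓡 m) x) :=
    IsContMDiffRiemannianBundle.isContinuousRiemannianBundle (I := 𝓡 m) (k := ∞) inferInstance
  have : IsContinuousRiemannianBundle (EuclideanSpace ℝ (Fin n))
      (fun y : N => TangentSpace (𝓡 n) y) :=
    IsContMDiffRiemannianBundle.isContinuousRiemannianBundle (I := 𝓡 n) (k := ∞) inferInstance
  -- For empty M the numbers m and n may differ, and the dimension count needs a point.
  rcases isEmpty_or_nonempty M with hM | hM
  · have : IsEmpty N := F.symm.toEquiv.isEmpty
    exact ⟨⟨F.toEquiv, fun x => isEmptyElim x, fun y => isEmptyElim y⟩⟩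
  obtain ⟨x₀⟩ := hM
  obtain ⟨K, hK⟩ := hF
  obtain ⟨K', hK'⟩ := hFsymm
  have hnm : n ≤ m := by
    simpa using finrank_le_of_lipschitzWith_homeomorph (E := EuclideanSpace ℝ (Fin m))
      (E' := EuclideanSpace ℝ (Fin n)) F hK x₀
  have hmn : m ≤ n := by
    simpa using finrank_le_of_lipschitzWith_homeomorph (E := EuclideanSpace ℝ (Fin n))
      (E' := EuclideanSpace ℝ (Fin m)) F.symm hK' (F x₀)
  -- With equal dimensions, maximal rank means injective.
  obtain rfl : m = n := le_antisymm hmn hnm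
  refine nonempty_diffeomorph_of_mCoerciveAt F fun x => ?_
  obtain ⟨L, U, hU, hL⟩ := hK.exists_lipschitzOnWith_charts (E := EuclideanSpace ℝ (Fin m))
    (E' := EuclideanSpace ℝ (Fin m)) x
  refine coerciveAt_of_forall_injective hU hL fun A hA => ?_
  have hA' := convexHull_mono (limitFDerivs_subset_limitDifferentials F.continuous x) hA
  have := hsing x A hA'
  rw [min_self] at this
  exact injective_of_finrank_range_eq this
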